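/- **Setting.** For a random vector $\xi$ in $\mathbb R^k$ let $\|\xi\|_{\psi_2}=\sup_{\|v\|=1}\sup_{q\ge 1}q^{-1/2}\,\mathbb E[|\langle \xi,v\rangle|^q]^{1/q}$ and $\Sigma_\xi=\mathbb E[\xi\otimes\xi]$. Let $A\in\mathbb R^{m\times d}$ be injective with spectral norm $\|A\|=1$, let $X\in\mathbb R^d$ and $W\in\mathbb R^m$ be independent random vectors with $\|X\|_{\psi_2}=1$, $\|W\|_{\psi_2}=1/\sqrt2$, $\mathbb E[W]=0$, let $0<\sigma<\sqrt2$, and put $Y=AX+\sigma W$. Let $h=\operatorname{rank}\Sigma_X$, let $\lambda_{\min}$ be the smallest nonzero eigenvalue of $\Sigma_{AX}$, and let $\Pi$ be the orthogonal projection onto $\operatorname{ran}\Sigma_{AX}$. Let $(u_i,v_i,\sigma_i)_{i=1}^d$ be a singular value decomposition of $A$ with $\sigma_1\ge\dots\ge\sigma_d>0$, and let $p=\max\{i\mid \Pi u_i\neq0\}$. Let $Y_i=AX_i+\sigma W_i$, $i=1,\dots,n$, be independent, each pair $(X_i,W_i)$ being distributed as $(X,W)$; let $\widehat\Sigma=\frac1n\sum_{i=1}^nY_i\otimes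 Y_i$, let $\widehat\Pi$ be the orthogonal projection onto the span of the first $h$ eigenvectors of $\widehat\Sigma$ (eigenvalues repeated and in nonincreasing order; any choice of eigenbasis is allowed), and let $\widehat X=A^\dagger\widehat\Pi Y$, where $A^\dagger$ is the pseudo-inverse. For $t\in[0,1)$ let $Z^t$ be the minimizer over $z\in\mathbb R^d$ of $t\|Az-Y\|^2+(1-t)\|z\|^2$, and let $Z^1=A^\dagger Y$. Define, for $t\in[0,1]$ (with one-sided derivatives at the end points), $$H(t)=\tfrac12\tfrac{d}{dt}\|Z^t-X\|^2,\qquad \widehat H(t)=\langle \widehat R(t),\widehat R'(t)\rangle,\quad \widehat R(t)=Z^t-\widehat X,$$ and $$B(n,\tau,\sigma)=\frac1{\lambda_{\min}}\sqrt{\frac{hm}n}+\sigma\Big(\sqrt h+\frac1{\lambda_{\min}}\frac m{\sqrt n}\Big)+\frac{\sigma^2}{\lambda_{\min}}\sqrt h+\frac{\sigma^3}{\lambda_{\min}}\sqrt m+\tau\Big(\frac1{\lambda_{\min}}\sqrt{\frac mn}+\sigma\Big(1+\frac1{\lambda_{\min}}\sqrt{\frac mn}\Big)+\frac{\sigma^2}{\lambda_{\min}}\Big)+\frac{\tau^2}{\lambda_{\min}\sqrt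 n}.$$ **Theorem.** There are absolute constants $c,C>0$ such that in every such setting the map $t\mapsto Z^t$ is differentiable on $[0,1]$, and for every $\tau>0$ the following holds. If $$n\ge c\,(\sqrt m+\tau)^2\max\Big\{\frac{64}{\lambda_{\min}^2},1\Big\}\qquad\text{and}\qquad \sigma^2<\frac{\lambda_{\min}}8,$$ then, with probability greater than $1-10e^{-\tau^2}$, $$\sup_{0\le t\le1}\big|\widehat H(t)-H(t)\big|\le C\,B(n,\tau,\sigma)\Big(\frac{1}{\sigma_p^3}(\sqrt h+\tau)+\frac{\sigma}{\sigma_d^4}(\sqrt d+\tau)\Big).$$ -/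

import Mathlib

open MeasureTheory ProbabilityTheory Set

noncomputable section

/-- The Euclidean space of dimension `k`. An `m × d` real matrix is used through the linear map
`Euc d →L[ℝ] Euc m` it induces; the norm of that map is the spectral norm of the matrix. -/
abbrev Euc (k : ℕ) := EuclideanSpace ℝ (Fin k)

/-- The sub-gaussian norm `sup_{‖v‖ = 1} sup_{q ≥ 1} q^{-1/2} (E |⟨ξ, v⟩|^q)^{1/q}` of a random
vector, with values in `[0, ∞]`. -/
def psi2Norm {Ω : Type*} [MeasurableSpace Ω] {k : ℕ} (ξ : Ω → Euc k) (μ : Measure Ω) : ENNReal :=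
  ⨆ v ∈ Metric.sphere (0 : Euc k) 1, ⨆ q ∈ Set.Ici (1 : ℝ),
    ENNReal.ofReal (q ^ (-(1 / 2) : ℝ)) *
      eLpNorm (fun ω => inner ℝ (ξ ω) v) (ENNReal.ofReal q) μ

/-- The noncentered covariance `Σ_ξ = E[ξ ⊗ ξ]`, where `ξ ⊗ ξ` is `z ↦ ⟨ξ, z⟩ ξ`. -/
def covOp {Ω : Type*} [MeasurableSpace Ω] {k : ℕ} (ξ : Ω → Euc k) (μ : Measure Ω) :
    Euc k →L[ℝ] Euc k :=
  ∫ ω, InnerProductSpace.rankOne ℝ (ξ ω) (ξ ω) ∂μ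

/-- The empirical noncentered covariance `(1/n) ∑ yᵢ ⊗ yᵢ`. -/
def empCovOp {n k : ℕ} (y : Fin n → Euc k) : Euc k →L[ℝ] Euc k :=
  (n : ℝ)⁻¹ • ∑ i, InnerProductSpace.rankOne ℝ (y i) (y i)

/-- The orthogonal projection onto the range of an operator. -/
def ranProj {k : ℕ} (S : Euc k →L[ℝ] Euc k) : Euc k →L[ℝ] Euc k :=
  S.range.starProjection

/-- `P` is an orthogonal projection onto the span of the first `r` eigenvectors of `S`: there is
an orthonormal basis of eigenvectors, ordered so that the (repeated) eigenvalues are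
nonincreasing, such that `P` projects onto the span of its first `r` members. The projection `P`
is determined by `S` and `r` when there is a gap after the `r`-th eigenvalue. -/
def IsTopEigenProj {k : ℕ} (r : ℕ) (S P : Euc k →L[ℝ] Euc k) : Prop :=
  ∃ (b : OrthonormalBasis (Fin k) ℝ (Euc k)) (ev : Fin k → ℝ),
    Antitone ev ∧ (∀ j, S (b j) = ev j • b j) ∧
      P = (Submodule.span ℝ (b '' {j : Fin k | (j : ℕ) < r})).starProjection

/-- `(uᵢ, vᵢ, sᵢ)`, `i = 1, …, d`, is a singular value decomposition of `A`, with the singular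
values in nonincreasing order (`i : Fin d` stands for the index `i + 1`). -/
structure IsSVD {d m : ℕ} (A : Euc d →L[ℝ] Euc m) (u : Fin d → Euc m) (v : Fin d → Euc d)
    (s : Fin d → ℝ) : Prop where
  orthonormal_left : Orthonormal ℝ u
  orthonormal_right : Orthonormal ℝ v
  nonneg : ∀ i, 0 ≤ s i
  antitone : Antitone s
  map_right : ∀ i, A (v i) = s i • u i

/-- The pseudo-inverse `A† = (AᵀA)⁻¹Aᵀ` of an injective `A`. -/
def pinv {d m : ℕ} (A : Euc d →L[ℝ] Euc m) : Euc m →L[ℝ] Euc d :=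
  (A.adjoint ∘L A).inverse ∘L A.adjoint

theorem gram_isInvertible {d m : ℕ} (A : Euc d →L[ℝ] Euc m) (hA : Function.Injective A) :
    (A.adjoint ∘L A).IsInvertible := by
  have hinj : Function.Injective (A.adjoint ∘L A) := by
    rw [injective_iff_map_eq_zero]
    intro x hx
    have h0 : inner ℝ (A x) (A x) = 0 := by
      rw [← ContinuousLinearMap.adjoint_inner_left]
      simp only [ContinuousLinearMap.comp_apply] at hx
      rw [hx, inner_zero_left]
    exact hA (by rw [inner_self_eq_zero.mp h0, map_zero])
  exact ⟨(LinearEquiv.ofInjectiveEndo (A.adjoint ∘L A).toLinearMap hinj).toContinuousLinearEquiv,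
    by ext x; rfl⟩

/-- For injective `A`, the operator `pinv A` satisfies the four Moore-Penrose equations. -/
theorem pinv_penrose {d m : ℕ} (A : Euc d →L[ℝ] Euc m) (hA : Function.Injective A) :
    A ∘L pinv A ∘L A = A ∧ pinv A ∘L A ∘L pinv A = pinv A ∧
      IsSelfAdjoint (A ∘L pinv A) ∧ IsSelfAdjoint (pinv A ∘L A) := by
  have hG := gram_isInvertible A hA
  have h : pinv A ∘L A = ContinuousLinearMap.id ℝ (Euc d) := by
    rw [pinv, ContinuousLinearMap.comp_assoc, hG.inverse_comp_self]
  refine ⟨?_, ?_, ?_, ?_⟩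
  · rw [h]; simp
  · rw [← ContinuousLinearMap.comp_assoc, h]; simp
  · have key : ∀ a b : Euc d, inner ℝ ((A.adjoint ∘L A).inverse a) b =
        inner ℝ a ((A.adjoint ∘L A).inverse b) := by
      intro a b
      have ha := hG.self_apply_inverse a
      have hb := hG.self_apply_inverse b
      rw [ContinuousLinearMap.comp_apply] at ha hb
      conv_lhs => rw [← hb]
      conv_rhs => rw [← ha]
      rw [ContinuousLinearMap.adjoint_inner_left, ContinuousLinearMap.adjoint_inner_right]
    rw [ContinuousLinearMap.isSelfAdjoint_iff_isSymmetric]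
    intro x y
    change inner ℝ (A ((A.adjoint ∘L A).inverse (A.adjoint x))) y =
      inner ℝ x (A ((A.adjoint ∘L A).inverse (A.adjoint y)))
    rw [← ContinuousLinearMap.adjoint_inner_right, key, ContinuousLinearMap.adjoint_inner_left]
  · rw [h]; exact IsSelfAdjoint.one _

/-- The Tikhonov functional `t ‖A z - y‖² + (1 - t) ‖z‖²`. -/
def tikhonovFun {d m : ℕ} (A : Euc d →L[ℝ] Euc m) (y : Euc m) (t : ℝ) (z : Euc d) : ℝ :=
  t * ‖A z - y‖ ^ 2 + (1 - t) * ‖z‖ ^ 2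

open Classical in
/-- The regularized solution `Z^t`, `t ∈ [0,1]`: the minimizer of the Tikhonov functional (which
exists and is unique) when `t < 1`, and `A† y` when `t = 1`. -/
def tikhonov {d m : ℕ} (A : Euc d →L[ℝ] Euc m) (y : Euc m) (t : ℝ) : Euc d :=
  if t = 1 then pinv A y
  else Classical.epsilon fun z => IsMinOn (tikhonovFun A y t) Set.univ z

/-- `H(t) = ½ d/dt ‖Z^t - x‖²` on `[0,1]` (one-sided derivatives at the end points). -/
def derivFun {d m : ℕ} (A : Euc d →L[ℝ] Euc m) (y : Euc m) (x : Euc d) (t : ℝ) : ℝ :=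
  1 / 2 * derivWithin (fun s => ‖tikhonov A y s - x‖ ^ 2) (Set.Icc 0 1) t

/-- The empirical estimator `x̂ = A† P y`. -/
def empSignal {d m : ℕ} (A : Euc d →L[ℝ] Euc m) (P : Euc m →L[ℝ] Euc m) (y : Euc m) : Euc d :=
  pinv A (P y)

/-- The empirical counterpart `Ĥ(t) = ⟨R̂(t), R̂'(t)⟩` of `H`, where `R̂(t) = Z^t - x̂` and
`x̂ = A† P y`. -/
def empDerivFun {d m : ℕ} (A : Euc d →L[ℝ] Euc m) (P : Euc m →L[ℝ] Euc m) (y : Euc m) (t : ℝ) :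
    ℝ :=
  inner ℝ (tikhonov A y t - empSignal A P y)
    (derivWithin (fun s => tikhonov A y s - empSignal A P y) (Set.Icc 0 1) t)

/-- The quantity `B(n, τ, σ)`, for signals in an `h`-dimensional space, data in dimension `m` and
smallest nonzero eigenvalue `lam`. -/
def boundB (m h n : ℕ) (lam τ σ : ℝ) : ℝ :=
  1 / lam * √((h * m : ℝ) / n) + σ * (√h + 1 / lam * (m / √n)) + σ ^ 2 / lam * √h
    + σ ^ 3 / lam * √m
    + τ * (1 / lam * √((m : ℝ) / n) + σ * (1 + 1 / lam * √((m : ℝ) / n)) + σ ^ 2 / lam)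
    + τ ^ 2 * (1 / lam) * (1 / √n)

end

/-! In singular coordinates, `Z^t` has coefficients `t sᵢ⟨uᵢ,Y⟩ / (t sᵢ² + 1 - t)`, and its
derivative has coefficients `sᵢ⟨uᵢ,Y⟩ / (t sᵢ² + 1 - t)²`. Both `Ĥ` and `H` pair with this same
derivative, so `Ĥ - H = ⟨X - X̂, (Z^t)'⟩`. The factor `sᵢ` cancels the `1/sᵢ` of the pseudo-inverse,
leaving `⟨AX - PY, ∑ ⟨uᵢ,Y⟩ / (t sᵢ² + 1 - t)² uᵢ⟩` (`empDerivFun_sub_derivFun`), and Cauchy-Schwarz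
separates the two factors.

The filtered data are bounded uniformly in `t`, because `t sᵢ² + 1 - t ≥ sᵢ²`. Since `⟨uᵢ,AX⟩ =
sᵢ⟨vᵢ,X⟩` vanishes almost surely for `i > p`, the signal costs `σ_p⁻³`, while the noise costs
`σ_d⁻⁴`.

For the other factor, `AX = ΠAX` almost surely, so `AX - PY = (Π - P)Y - σΠW`. A Davis-Kahan
argument (`norm_ranProj_sub_topEigenProj_le`) gives `‖Π - P‖ ≤ (4/λ)‖Σ̂ - Σ_AX‖`. The right side is
of order `((√m + τ)/√n + σ²)/λ`: a Bernstein bound on a net of the sphere handles the fluctuation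
(`measure_norm_empCovOp_sub_le`), and `σ²` is the bias due to the noise. Nets also give `‖X‖ ≲ √h +
τ` and bounds `√h + τ`, `√d + τ`, `√m + τ` for `W` projected on `ran Σ_AX`, on `ran A` and on the
whole space. All bad events are independent of `t` and `P`. -/

noncomputable section

/-! ### Singular value coordinates -/

namespace IsSVD

variable {d m : ℕ} {A : Euc d →L[ℝ] Euc m} {u : Fin d → Euc m} {v : Fin d → Euc d} {s : Fin d → ℝ}

/-- The right singular vectors, as an orthonormal basis. -/
def basis (hs : IsSVD A u v s) : OrthonormalBasis (Fin d) ℝ (Euc d) :=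
  OrthonormalBasis.mk hs.orthonormal_right (by
    rw [hs.orthonormal_right.linearIndependent.span_eq_top_of_card_eq_finrank' (by simp)])

@[simp]
theorem basis_apply (hs : IsSVD A u v s) (i : Fin d) : hs.basis i = v i := by
  simp [basis]

theorem ext_inner (hs : IsSVD A u v s) {x y : Euc d}
    (h : ∀ i, inner ℝ (v i) x = (inner ℝ (v i) y : ℝ)) : x = y := by
  refine hs.basis.repr.injective ?_
  ext i
  simpa [OrthonormalBasis.repr_apply_apply] using h i

theorem adjoint_left (hs : IsSVD A u v s) (i : Fin d) : A.adjoint (u i) = s i • v i := by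
  refine hs.ext_inner fun j => ?_
  rw [ContinuousLinearMap.adjoint_inner_right, hs.map_right, real_inner_smul_left,
    real_inner_smul_right, orthonormal_iff_ite.mp hs.orthonormal_left,
    orthonormal_iff_ite.mp hs.orthonormal_right]
  split_ifs with h
  · rw [h]
  · simp

theorem inner_left_map (hs : IsSVD A u v s) (i : Fin d) (x : Euc d) :
    inner ℝ (u i) (A x) = s i * inner ℝ (v i) x := by
  rw [← ContinuousLinearMap.adjoint_inner_left, hs.adjoint_left, real_inner_smul_left]

theorem pos (hs : IsSVD A u v s) (hA : Function.Injective A) (i : Fin d) : 0 < s i := by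
  refine lt_of_le_of_ne (hs.nonneg i) fun h => ?_
  have h1 : A (v i) = A 0 := by rw [hs.map_right, ← h, zero_smul, map_zero]
  exact hs.orthonormal_right.ne_zero i (hA h1)

theorem le_one (hs : IsSVD A u v s) (hA : ‖A‖ ≤ 1) (i : Fin d) : s i ≤ 1 := by
  have h := A.le_opNorm (v i)
  rw [hs.map_right, norm_smul, hs.orthonormal_left.1, hs.orthonormal_right.1, Real.norm_eq_abs,
    abs_of_nonneg (hs.nonneg i)] at h
  linarith

theorem left_mem_range (hs : IsSVD A u v s) (hA : Function.Injective A) (i : Fin d) :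
    u i ∈ A.range := by
  refine ⟨(s i)⁻¹ • v i, ?_⟩
  change A _ = _
  rw [map_smul, hs.map_right, smul_smul, inv_mul_cancel₀ (hs.pos hA i).ne', one_smul]

/-- Pairing the normal equation `A*A(A†y) = A*y` with `vᵢ` gives this after division by `sᵢ²`. -/
theorem inner_right_pinv (hs : IsSVD A u v s) (hA : Function.Injective A) (i : Fin d)
    (y : Euc m) : inner ℝ (v i) (pinv A y) = inner ℝ (u i) y / s i := by
  have h1 : A.adjoint (A (pinv A y)) = A.adjoint y := by
    have := (gram_isInvertible A hA).self_apply_inverse (A.adjoint y)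
    simpa [pinv] using this
  have h2 : inner ℝ (v i) (A.adjoint (A (pinv A y))) = inner ℝ (v i) (A.adjoint y) := by rw [h1]
  rw [ContinuousLinearMap.adjoint_inner_right, ContinuousLinearMap.adjoint_inner_right,
    hs.map_right, real_inner_smul_left, real_inner_smul_left, hs.inner_left_map] at h2
  have h3 := hs.pos hA i
  have h4 := mul_left_cancel₀ h3.ne' h2
  field_simp
  linarith

theorem inner_basis_sum (hs : IsSVD A u v s) (c : Fin d → ℝ) (i : Fin d) :
    inner ℝ (v i) (∑ j, c j • v j) = c i :=
  hs.orthonormal_right.inner_right_fintype c i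

/-- The denominator `t s² + 1 - t` of the Tikhonov filter is at least `s²`. -/
theorem sq_le_filter {t a : ℝ} (ht : t ∈ Icc (0 : ℝ) 1) (h0 : 0 < a) (h1 : a ≤ 1) :
    a ^ 2 ≤ t * a ^ 2 + (1 - t) := by
  have h2 : a ^ 2 ≤ 1 := by nlinarith
  nlinarith [ht.1, ht.2, mul_nonneg (sub_nonneg.2 ht.2) (sub_nonneg.2 h2)]

theorem filter_pos (hs : IsSVD A u v s) (hA : Function.Injective A) {t : ℝ}
    (ht : t ∈ Icc (0 : ℝ) 1) (i : Fin d) : 0 < t * s i ^ 2 + (1 - t) := by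
  have h := pow_pos (hs.pos hA i) 2
  rcases eq_or_lt_of_le ht.2 with h1 | h1
  · rw [h1]; linarith
  · nlinarith [mul_nonneg ht.1 h.le]

end IsSVD

/-! ### The Tikhonov path and the deterministic error bound -/

/-- Completing the square: the normal equation for `w` kills the cross term. -/
theorem tikhonovFun_add {d m : ℕ} (A : Euc d →L[ℝ] Euc m) (y : Euc m) (t : ℝ) (w z : Euc d)
    (hw : t • A.adjoint (A w - y) + (1 - t) • w = 0) :
    tikhonovFun A y t (w + z) = tikhonovFun A y t w + (t * ‖A z‖ ^ 2 + (1 - t) * ‖z‖ ^ 2) := by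
  have h0 : t * inner ℝ (A w - y) (A z) + (1 - t) * inner ℝ w z = 0 := by
    have h : inner ℝ (t • A.adjoint (A w - y) + (1 - t) • w) z = (0 : ℝ) := by
      rw [hw, inner_zero_left]
    rwa [inner_add_left, real_inner_smul_left, real_inner_smul_left,
      ContinuousLinearMap.adjoint_inner_left] at h
  have h1 : A (w + z) - y = (A w - y) + A z := by rw [map_add]; abel
  unfold tikhonovFun
  rw [h1, norm_add_sq_real, norm_add_sq_real]
  linear_combination 2 * h0

/-- For `t < 1` the excess over the value at `w` is at least `(1 - t)‖z - w‖²`, so the minimizer is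
unique and the choice in `tikhonov` must return `w`. -/
theorem tikhonov_eq_of_normal_eq {d m : ℕ} (A : Euc d →L[ℝ] Euc m) (y : Euc m) {t : ℝ}
    (ht : t ∈ Ico (0 : ℝ) 1) (w : Euc d)
    (hw : t • A.adjoint (A w - y) + (1 - t) • w = 0) : tikhonov A y t = w := by
  have hmin : IsMinOn (tikhonovFun A y t) univ w := by
    intro z _
    have h := tikhonovFun_add A y t w (z - w) hw
    rw [add_sub_cancel] at h
    have h1 := mul_nonneg ht.1 (sq_nonneg ‖A (z - w)‖)
    have h2 := mul_nonneg (sub_nonneg.2 ht.2.le) (sq_nonneg ‖z - w‖)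
    change tikhonovFun A y t w ≤ tikhonovFun A y t z
    linarith
  have hepsmin : IsMinOn (tikhonovFun A y t) univ (tikhonov A y t) := by
    unfold tikhonov
    rw [if_neg ht.2.ne]
    exact Classical.epsilon_spec ⟨w, hmin⟩
  have h := tikhonovFun_add A y t w (tikhonov A y t - w) hw
  rw [add_sub_cancel] at h
  have h1 := mul_nonneg ht.1 (sq_nonneg ‖A (tikhonov A y t - w)‖)
  have h3 : tikhonovFun A y t (tikhonov A y t) ≤ tikhonovFun A y t w := hepsmin (mem_univ w)
  have h4 : (1 - t) * ‖tikhonov A y t - w‖ ^ 2 ≤ 0 := by linarith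
  have h5 : 0 < 1 - t := sub_pos.2 ht.2
  have h6 : ‖tikhonov A y t - w‖ ^ 2 ≤ 0 := by
    by_contra! h
    have := mul_pos h5 h
    linarith
  exact sub_eq_zero.1 (norm_eq_zero.1 (pow_eq_zero_iff two_ne_zero |>.1
    (le_antisymm h6 (sq_nonneg _))))

namespace IsSVD

variable {d m : ℕ} {A : Euc d →L[ℝ] Euc m} {u : Fin d → Euc m} {v : Fin d → Euc d} {s : Fin d → ℝ}

/-- The filter formula also covers `t = 1`, where it becomes `1/sᵢ²` and reproduces `A†y`; this
makes differentiation at the end point unproblematic. -/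
theorem tikhonov_eq (hs : IsSVD A u v s) (hA : Function.Injective A) (y : Euc m) {t : ℝ}
    (ht : t ∈ Icc (0 : ℝ) 1) :
    tikhonov A y t = ∑ i, (t / (t * s i ^ 2 + (1 - t))) • (s i * inner ℝ (u i) y) • v i := by
  rcases eq_or_lt_of_le ht.2 with h1 | h1
  · subst h1
    rw [tikhonov, if_pos rfl]
    refine hs.ext_inner fun i => ?_
    simp only [smul_smul]
    rw [hs.inner_right_pinv hA, hs.inner_basis_sum]
    have := (hs.pos hA i).ne'
    field_simp
    ring
  · refine tikhonov_eq_of_normal_eq A y ⟨ht.1, h1⟩ _ ?_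
    refine hs.ext_inner fun i => ?_
    simp only [smul_smul]
    rw [inner_zero_right, inner_add_right, real_inner_smul_right,
      real_inner_smul_right, hs.inner_basis_sum, ContinuousLinearMap.adjoint_inner_right,
      hs.map_right, real_inner_smul_left, inner_sub_right, hs.inner_left_map, hs.inner_basis_sum]
    have := (hs.filter_pos hA ht i).ne'
    field_simp
    ring

/-- The derivative of the Tikhonov path in terms of a singular value decomposition. -/
def tikhonovDeriv (u : Fin d → Euc m) (v : Fin d → Euc d) (s : Fin d → ℝ) (y : Euc m) (t : ℝ) :
    Euc d :=
  ∑ i, (1 / (t * s i ^ 2 + (1 - t)) ^ 2) • (s i * inner ℝ (u i) y) • v i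

theorem hasDerivWithinAt_tikhonov (hs : IsSVD A u v s) (hA : Function.Injective A) (y : Euc m)
    {t : ℝ} (ht : t ∈ Icc (0 : ℝ) 1) :
    HasDerivWithinAt (tikhonov A y) (tikhonovDeriv u v s y t) (Icc 0 1) t := by
  have h : HasDerivWithinAt
      (fun t : ℝ => ∑ i, (t / (t * s i ^ 2 + (1 - t))) • (s i * inner ℝ (u i) y) • v i)
      (tikhonovDeriv u v s y t) (Icc 0 1) t := by
    refine HasDerivWithinAt.fun_sum fun i _ => HasDerivWithinAt.smul_const ?_ _
    have hpos := (hs.filter_pos hA ht i).ne'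
    have h1 : HasDerivAt (fun t : ℝ => t * s i ^ 2 + (1 - t)) (1 * s i ^ 2 + (0 - 1)) t :=
      ((hasDerivAt_id t).mul_const _).add ((hasDerivAt_const t 1).sub (hasDerivAt_id t))
    -- The numerator of the quotient rule is `(t sᵢ² + 1 - t) - t(sᵢ² - 1) = 1`.
    have h2 := (hasDerivAt_id t).div h1 hpos
    refine (h2.congr_deriv ?_).hasDerivWithinAt
    simp only [id]
    congr 1
    ring
  exact h.congr (fun t ht => hs.tikhonov_eq hA y ht) (hs.tikhonov_eq hA y ht)

/-- Subtracting a fixed vector does not change the derivative of the path, so only `⟨x - x̂,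
(Z^t)'⟩` survives. The factors `sᵢ` and `1/sᵢ` cancel, which moves the comparison to data space. -/
theorem empDerivFun_sub_derivFun (hs : IsSVD A u v s) (hA : Function.Injective A) (y : Euc m)
    (x : Euc d) (P : Euc m →L[ℝ] Euc m) {t : ℝ} (ht : t ∈ Icc (0 : ℝ) 1) :
    empDerivFun A P y t - derivFun A y x t =
      inner ℝ (A x - P y) (∑ i, (inner ℝ (u i) y / (t * s i ^ 2 + (1 - t)) ^ 2) • u i) := by
  have hu : UniqueDiffWithinAt ℝ (Icc (0 : ℝ) 1) t := uniqueDiffOn_Icc_zero_one t ht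
  have h := hs.hasDerivWithinAt_tikhonov hA y ht
  have h1 := (h.sub_const (empSignal A P y)).derivWithin hu
  have h2 := (h.sub_const x).norm_sq.derivWithin hu
  unfold empDerivFun derivFun
  rw [h1, h2]
  have h3 : inner ℝ (tikhonov A y t - empSignal A P y) (tikhonovDeriv u v s y t) -
      1 / 2 * (2 * inner ℝ (tikhonov A y t - x) (tikhonovDeriv u v s y t)) =
      inner ℝ (x - empSignal A P y) (tikhonovDeriv u v s y t) := by
    simp only [inner_sub_left]; ring
  rw [h3, tikhonovDeriv, inner_sum, inner_sum]
  refine Finset.sum_congr rfl fun i _ => ?_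
  rw [real_inner_smul_right, real_inner_smul_right, real_inner_smul_right, inner_sub_left,
    inner_sub_left, empSignal, real_inner_comm (v i) x, real_inner_comm (v i) (pinv A _),
    hs.inner_right_pinv hA, real_inner_comm (u i) (A x), hs.inner_left_map,
    real_inner_comm (u i) (P y)]
  have := (hs.pos hA i).ne'
  field_simp

theorem norm_sum_smul_left_le (hs : IsSVD A u v s) (a b : Fin d → ℝ) (h : ∀ i, |a i| ≤ |b i|)
    {M : ℝ} (hM : 0 ≤ M) (hb : ∑ i, b i ^ 2 ≤ M ^ 2) : ‖∑ i, a i • u i‖ ≤ M := by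
  have h1 : ‖∑ i, a i • u i‖ ^ 2 = ∑ i, a i ^ 2 := by
    rw [← real_inner_self_eq_norm_sq, hs.orthonormal_left.inner_sum]
    simp [sq]
  refine le_of_sq_le_sq ?_ hM
  rw [h1]
  exact (Finset.sum_le_sum fun i _ => sq_le_sq.2 (h i)).trans hb

/-- Bessel's inequality for the projected vector: each `uᵢ` lies in `ran A`. Thus the noise later
contributes `√d` rather than `√m`. -/
theorem sum_inner_left_sq_le (hs : IsSVD A u v s) (hA : Function.Injective A) (w : Euc m) :
    ∑ i, inner ℝ (u i) w ^ 2 ≤ ‖A.range.starProjection w‖ ^ 2 := by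
  have h := hs.orthonormal_left.sum_inner_products_le (A.range.starProjection w)
    (s := Finset.univ)
  refine le_trans (le_of_eq ?_) h
  refine Finset.sum_congr rfl fun i _ => ?_
  rw [Real.norm_eq_abs, sq_abs, ← Submodule.inner_starProjection_left_eq_right,
    Submodule.starProjection_eq_self_iff.2 (hs.left_mem_range hA i)]

/-- The squared filter denominator is at least `sᵢ⁴`. The signal coefficient carries a factor `sᵢ`,
leaving `sᵢ⁻³ ≤ s_p⁻³` for `i ≤ p` and zero beyond; the noise coefficient has no such factor. -/
theorem abs_empDerivFun_sub_derivFun_le (hs : IsSVD A u v s) (hA : Function.Injective A)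
    (hA1 : ‖A‖ ≤ 1) [NeZero d] (p : Fin d) (x : Euc d) (w : Euc m) {σ : ℝ} (hσ : 0 ≤ σ)
    (hp : ∀ i, p < i → inner ℝ (u i) (A x) = (0 : ℝ))
    (P : Euc m →L[ℝ] Euc m) {t : ℝ} (ht : t ∈ Icc (0 : ℝ) 1) :
    |empDerivFun A P (A x + σ • w) t - derivFun A (A x + σ • w) x t| ≤
      ‖A x - P (A x + σ • w)‖ *
        (1 / s p ^ 3 * ‖x‖ + σ / s ⊤ ^ 4 * ‖A.range.starProjection w‖) := by
  rw [hs.empDerivFun_sub_derivFun hA _ _ _ ht]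
  refine (abs_real_inner_le_norm _ _).trans (mul_le_mul_of_nonneg_left ?_ (norm_nonneg _))
  have hdecomp : ∑ i, (inner ℝ (u i) (A x + σ • w) / (t * s i ^ 2 + (1 - t)) ^ 2) • u i =
      (∑ i, (inner ℝ (u i) (A x) / (t * s i ^ 2 + (1 - t)) ^ 2) • u i) +
        σ • ∑ i, (inner ℝ (u i) w / (t * s i ^ 2 + (1 - t)) ^ 2) • u i := by
    rw [Finset.smul_sum, ← Finset.sum_add_distrib]
    refine Finset.sum_congr rfl fun i _ => ?_
    rw [smul_smul, ← add_smul, inner_add_right, real_inner_smul_right]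
    ring_nf
  have hfil : ∀ i, s i ^ 4 ≤ (t * s i ^ 2 + (1 - t)) ^ 2 := fun i => by
    have := sq_le_filter ht (hs.pos hA i) (hs.le_one hA1 i)
    calc s i ^ 4 = (s i ^ 2) ^ 2 := by ring
      _ ≤ _ := pow_le_pow_left₀ (sq_nonneg _) this 2
  have hsp := hs.pos hA p
  have hst := hs.pos hA ⊤
  have hX : ‖∑ i, (inner ℝ (u i) (A x) / (t * s i ^ 2 + (1 - t)) ^ 2) • u i‖ ≤
      1 / s p ^ 3 * ‖x‖ := by
    refine hs.norm_sum_smul_left_le _ (fun i => 1 / s p ^ 3 * inner ℝ (v i) x) (fun i => ?_)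
      (by positivity) (le_of_eq ?_)
    · rcases le_or_gt i p with hi | hi
      · have hsi := hs.pos hA i
        have h1 : s p ^ 3 ≤ s i ^ 3 := pow_le_pow_left₀ hsp.le (hs.antitone hi) 3
        rw [hs.inner_left_map, abs_div, abs_mul, abs_mul, abs_of_pos hsi,
          abs_of_nonneg (by positivity : 0 ≤ (t * s i ^ 2 + (1 - t)) ^ 2),
          abs_of_pos (by positivity : 0 < 1 / s p ^ 3)]
        calc s i * |inner ℝ (v i) x| / (t * s i ^ 2 + (1 - t)) ^ 2
            ≤ s i * |inner ℝ (v i) x| / s i ^ 4 := by gcongr; exact hfil i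
          _ = 1 / s i ^ 3 * |inner ℝ (v i) x| := by field_simp
          _ ≤ _ := by gcongr
      · rw [hp i hi, zero_div, abs_zero]; positivity
    · have := hs.basis.sum_sq_norm_inner_right x
      simp only [basis_apply, Real.norm_eq_abs, sq_abs] at this
      simp only [mul_pow]
      rw [← Finset.mul_sum, this]
  have hW : ‖∑ i, (inner ℝ (u i) w / (t * s i ^ 2 + (1 - t)) ^ 2) • u i‖ ≤
      1 / s ⊤ ^ 4 * ‖A.range.starProjection w‖ := by
    refine hs.norm_sum_smul_left_le _ (fun i => 1 / s ⊤ ^ 4 * inner ℝ (u i) w) (fun i => ?_)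
      (by positivity) ?_
    · have hsi := hs.pos hA i
      have h1 : s ⊤ ^ 4 ≤ s i ^ 4 := pow_le_pow_left₀ hst.le (hs.antitone le_top) 4
      rw [abs_div, abs_mul,
          abs_of_nonneg (by positivity : 0 ≤ (t * s i ^ 2 + (1 - t)) ^ 2),
          abs_of_pos (by positivity : 0 < 1 / s ⊤ ^ 4)]
      calc |inner ℝ (u i) w| / (t * s i ^ 2 + (1 - t)) ^ 2
            ≤ |inner ℝ (u i) w| / s ⊤ ^ 4 := by gcongr; exact h1.trans (hfil i)
        _ = _ := by ring
    · simp only [mul_pow]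
      rw [← Finset.mul_sum]
      exact mul_le_mul_of_nonneg_left (hs.sum_inner_left_sq_le hA w) (by positivity)
  rw [hdecomp]
  refine (norm_add_le _ _).trans (add_le_add hX ?_)
  rw [norm_smul, Real.norm_eq_abs, abs_of_nonneg hσ]
  calc σ * _ ≤ σ * (1 / s ⊤ ^ 4 * ‖A.range.starProjection w‖) := by gcongr
    _ = _ := by ring

end IsSVD

/-! ### Nets of the sphere -/

/-- The unit sphere of a `k`-dimensional Euclidean space has a `1/2`-net of at most `5 ^ k`
points. -/
theorem exists_sphere_net (F : Type*) [NormedAddCommGroup F] [InnerProductSpace ℝ F]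
    [FiniteDimensional ℝ F] :
    ∃ N : Finset F, N.card ≤ 5 ^ Module.finrank ℝ F ∧ (∀ v ∈ N, ‖v‖ = 1) ∧
      ∀ x : F, ‖x‖ = 1 → ∃ v ∈ N, ‖x - v‖ ≤ 1 / 2 := by
  classical
  -- The count `5 ^ dim` is available for 1-separated points in the ball of radius 2, so the net is
  -- built on the sphere of radius 2 and halved at the end.
  let Sep : Finset F → Prop := fun s =>
    (∀ c ∈ s, ‖c‖ = 2) ∧ ∀ c ∈ s, ∀ d ∈ s, c ≠ d → 1 ≤ ‖c - d‖
  have hcard : ∀ s, Sep s → s.card ≤ 5 ^ Module.finrank ℝ F := fun s hs =>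
    Besicovitch.card_le_of_separated s (fun c hc => (hs.1 c hc).le) hs.2
  -- If every separated set left some point uncovered, adding such points one by one would exceed
  -- the cardinality bound.
  have hmax : ∃ s, Sep s ∧ ∀ x : F, ‖x‖ = 2 → ∃ c ∈ s, ‖x - c‖ ≤ 1 := by
    by_contra! hno
    have hall : ∀ n : ℕ, ∃ s, Sep s ∧ s.card = n := by
      intro n
      induction n with
      | zero => exact ⟨∅, ⟨by simp, by simp⟩, rfl⟩
      | succ n ih =>
        obtain ⟨s, hs, hn⟩ := ih
        obtain ⟨x, hx, hxs⟩ := hno s hs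
        have hmem : x ∉ s := fun h => by
          have := hxs x h
          simp at this
          linarith
        refine ⟨insert x s, ⟨?_, ?_⟩, by rw [Finset.card_insert_of_notMem hmem, hn]⟩
        · intro c hc
          rcases Finset.mem_insert.1 hc with rfl | hc
          · exact hx
          · exact hs.1 c hc
        · intro c hc d hd hcd
          rcases Finset.mem_insert.1 hc with rfl | hc <;> rcases Finset.mem_insert.1 hd with rfl | hd
          · exact absurd rfl hcd
          · exact (hxs d hd).le
          · rw [norm_sub_rev]; exact (hxs c ‹_›).le
          · exact hs.2 c hc d hd hcd
    obtain ⟨s, hs, hn⟩ := hall (5 ^ Module.finrank ℝ F + 1)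
    have := hcard s hs
    omega
  obtain ⟨s, hs, hnet⟩ := hmax
  refine ⟨s.image fun c => (1 / 2 : ℝ) • c, Finset.card_image_le.trans (hcard s hs), ?_, ?_⟩
  · intro v hv
    obtain ⟨c, hc, rfl⟩ := Finset.mem_image.1 hv
    rw [norm_smul, hs.1 c hc]
    norm_num
  · intro x hx
    obtain ⟨c, hc, hxc⟩ := hnet ((2 : ℝ) • x) (by rw [norm_smul, hx]; norm_num)
    refine ⟨_, Finset.mem_image_of_mem _ hc, ?_⟩
    have : x - (1 / 2 : ℝ) • c = (1 / 2 : ℝ) • ((2 : ℝ) • x - c) := by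
      rw [smul_sub, smul_smul]; norm_num
    rw [this, norm_smul]
    norm_num
    linarith

/-- The net lies in the sphere of `S`, so its size depends on `dim S` alone and pairings with `x`
see only the projection `y`. A net point within `1/2` of `y/‖y‖` gives `‖y‖ ≤ M + ‖y‖/2`. -/
theorem exists_net_norm_starProjection_le {k : ℕ} (S : Submodule ℝ (Euc k)) :
    ∃ N : Finset (Euc k), N.card ≤ 5 ^ Module.finrank ℝ S ∧ (∀ v ∈ N, ‖v‖ = 1) ∧
      ∀ (x : Euc k) (M : ℝ), 0 ≤ M → (∀ v ∈ N, |inner ℝ x v| ≤ M) →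
        ‖S.starProjection x‖ ≤ 2 * M := by
  classical
  obtain ⟨N, hN, h1, hnet⟩ := exists_sphere_net S
  refine ⟨N.image Subtype.val, Finset.card_image_le.trans hN, ?_, ?_⟩
  · intro v hv
    obtain ⟨w, hw, rfl⟩ := Finset.mem_image.1 hv
    exact h1 w hw
  · intro x M hM hx
    set y := S.orthogonalProjectionOnto x with hy
    have hyx : S.starProjection x = (y : Euc k) := rfl
    rw [hyx]
    change ‖y‖ ≤ 2 * M
    rcases eq_or_ne y 0 with h0 | h0
    · rw [h0, norm_zero]; positivity
    have hpos : 0 < ‖y‖ := norm_pos_iff.2 h0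
    obtain ⟨v, hv, hyv⟩ := hnet (‖y‖⁻¹ • y) (by
      rw [norm_smul, norm_inv, norm_norm, inv_mul_cancel₀ hpos.ne'])
    have hxv : inner ℝ x (v : Euc k) = inner ℝ y v := by
      rw [hy, Submodule.inner_orthogonalProjectionOnto_eq_of_mem_right]
    have h3 := (le_abs_self _).trans (hx v (Finset.mem_image_of_mem _ hv))
    rw [hxv] at h3
    have h4 : inner ℝ y (‖y‖⁻¹ • y - v) ≤ ‖y‖ * (1 / 2) :=
      (real_inner_le_norm _ _).trans (mul_le_mul_of_nonneg_left hyv hpos.le)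
    have h5 : inner ℝ y (‖y‖⁻¹ • y) = ‖y‖ := by
      rw [real_inner_smul_right, real_inner_self_eq_norm_sq]
      field_simp
    rw [inner_sub_right, h5] at h4
    linarith

/-- By symmetry `⟨Tx,x⟩ - ⟨Tv,v⟩ = ⟨T(x - v), x + v⟩`. The triangle inequality would only give `‖x -
v‖‖x + v‖ ≤ 1`, too weak to absorb. The parallelogram law gives at most `√15/4 < 31/32`, whence the
factor 32. -/
theorem exists_net_norm_symmetric_le (k : ℕ) :
    ∃ N : Finset (Euc k), N.card ≤ 5 ^ k ∧ (∀ v ∈ N, ‖v‖ = 1) ∧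
      ∀ (T : Euc k →L[ℝ] Euc k) (M : ℝ), T.IsSymmetric → 0 ≤ M →
        (∀ v ∈ N, |inner ℝ (T v) v| ≤ M) → ‖T‖ ≤ 32 * M := by
  obtain ⟨N, hN, h1, hnet⟩ := exists_sphere_net (Euc k)
  refine ⟨N, by simpa using hN, h1, fun T M hT hM hv => ?_⟩
  have hsphere : ∀ x : Euc k, ‖x‖ = 1 → |inner ℝ (T x) x| ≤ M + 31 / 32 * ‖T‖ := by
    intro x hx
    obtain ⟨v, hvN, hxv⟩ := hnet x hx
    have hsplit : inner ℝ (T x) x = inner ℝ (T v) v + inner ℝ (T (x - v)) (x + v) := by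
      have := hT x v
      have h' : inner ℝ (T x) v = inner ℝ (T v) x := by
        rw [real_inner_comm x (T v)]; exact this
      rw [map_sub, inner_sub_left, inner_add_right, inner_add_right, h']
      ring
    have hpar := parallelogram_law_with_norm ℝ x v
    rw [hx, h1 v hvN] at hpar
    have hprod : ‖x - v‖ * ‖x + v‖ ≤ 31 / 32 := by
      refine le_of_sq_le_sq ?_ (by norm_num)
      have h5 : ‖x + v‖ ^ 2 = 4 - ‖x - v‖ ^ 2 := by linarith
      have h6 : ‖x - v‖ ^ 2 ≤ 1 / 4 := by
        calc ‖x - v‖ ^ 2 ≤ (1 / 2) ^ 2 := pow_le_pow_left₀ (norm_nonneg _) hxv 2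
          _ = 1 / 4 := by norm_num
      rw [mul_pow, h5]
      nlinarith
    have hcross : |inner ℝ (T (x - v)) (x + v)| ≤ 31 / 32 * ‖T‖ := by
      calc |inner ℝ (T (x - v)) (x + v)| ≤ ‖T (x - v)‖ * ‖x + v‖ := abs_real_inner_le_norm _ _
        _ ≤ ‖T‖ * ‖x - v‖ * ‖x + v‖ := by gcongr; exact T.le_opNorm _
        _ = ‖T‖ * (‖x - v‖ * ‖x + v‖) := by ring
        _ ≤ ‖T‖ * (31 / 32) := by gcongr
        _ = _ := by ring
    rw [hsplit]
    exact (abs_add_le _ _).trans (add_le_add (hv v hvN) hcross)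
  have hT' : ‖T‖ ≤ M + 31 / 32 * ‖T‖ := by
    conv_lhs => rw [T.norm_eq_iSup_rayleighQuotient hT]
    refine ciSup_le fun x => ?_
    rcases eq_or_ne x 0 with rfl | hx
    · simp; positivity
    have hpos : 0 < ‖x‖ := norm_pos_iff.2 hx
    have hone := hsphere (‖x‖⁻¹ • x) (by
      rw [norm_smul, norm_inv, norm_norm, inv_mul_cancel₀ hpos.ne'])
    refine le_trans (le_of_eq ?_) hone
    rw [map_smul, real_inner_smul_left, real_inner_smul_right, ContinuousLinearMap.rayleighQuotient,
      ContinuousLinearMap.reApplyInnerSelf_apply]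
    congr 1
    simp
    field_simp
  linarith

/-! ### Eigenbases and the Davis-Kahan bound -/

namespace OrthonormalBasis

variable {k : ℕ} (b : OrthonormalBasis (Fin k) ℝ (Euc k))

theorem norm_sq_eq_sum_inner (x : Euc k) : ‖x‖ ^ 2 = ∑ i, inner ℝ (b i) x ^ 2 := by
  have := b.sum_sq_norm_inner_right x
  simpa only [Real.norm_eq_abs, sq_abs] using this.symm

theorem inner_map_eigen {S : Euc k →L[ℝ] Euc k} (hS : S.IsSymmetric) {ev : Fin k → ℝ}
    (hb : ∀ j, S (b j) = ev j • b j) (x : Euc k) (j : Fin k) :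
    inner ℝ (b j) (S x) = ev j * inner ℝ (b j) x := by
  have : inner ℝ (S (b j)) x = inner ℝ (b j) (S x) := hS (b j) x
  rw [← this, hb, real_inner_smul_left]

theorem inner_eq_zero_of_mem_span {s : Set (Fin k)} {x : Euc k}
    (hx : x ∈ Submodule.span ℝ (b '' s)) {j : Fin k} (hj : j ∉ s) : inner ℝ (b j) x = (0 : ℝ) := by
  have hle : Submodule.span ℝ (b '' s) ≤ (innerSL ℝ (b j)).ker := by
    refine Submodule.span_le.2 ?_
    rintro _ ⟨i, hi, rfl⟩
    have hij : j ≠ i := fun h => hj (h ▸ hi)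
    simpa using b.orthonormal.2 hij
  exact hle hx

theorem finrank_span_image (s : Set (Fin k)) [Fintype s] :
    Module.finrank ℝ (Submodule.span ℝ (b '' s)) = Fintype.card s := by
  rw [image_eq_range]
  exact finrank_span_eq_card (b.orthonormal.linearIndependent.comp _ Subtype.val_injective)

theorem inner_starProjection_span (s : Set (Fin k)) [DecidablePred (· ∈ s)] (x : Euc k)
    (j : Fin k) :
    inner ℝ (b j) ((Submodule.span ℝ (b '' s)).starProjection x) =
      if j ∈ s then inner ℝ (b j) x else (0 : ℝ) := by
  split_ifs with hj
  · rw [← Submodule.inner_starProjection_left_eq_right, Submodule.starProjection_eq_self_iff.2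
      (Submodule.subset_span (mem_image_of_mem _ hj))]
  · exact b.inner_eq_zero_of_mem_span (Submodule.starProjection_apply_mem _ x) hj

end OrthonormalBasis

theorem exists_ne_zero_mem_inf {k : ℕ} (U V : Submodule ℝ (Euc k))
    (h : k < Module.finrank ℝ U + Module.finrank ℝ V) : ∃ x ≠ 0, x ∈ U ∧ x ∈ V := by
  have h1 := Submodule.finrank_sup_add_finrank_inf_eq U V
  have h2 := Submodule.finrank_le (U ⊔ V)
  rw [finrank_euclideanSpace_fin] at h2
  have h3 : U ⊓ V ≠ ⊥ := fun h0 => by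
    rw [h0, finrank_bot] at h1
    omega
  obtain ⟨x, hx, hx0⟩ := Submodule.exists_mem_ne_zero_of_ne_bot h3
  exact ⟨x, hx0, hx.1, hx.2⟩

/-- A Davis-Kahan bound for the top eigenspaces of a perturbation of an operator of rank `r` whose
nonzero eigenvalues are at least `lam`. -/
theorem norm_ranProj_sub_topEigenProj_le {k r : ℕ} {S S' P : Euc k →L[ℝ] Euc k}
    (hS : S.IsSymmetric) (hS' : S'.IsSymmetric) (hpos : ∀ x, 0 ≤ inner ℝ (S' x) x)
    {lam : ℝ} (hlam : 0 < lam) (hmin : ∀ x ∈ S.range, lam * ‖x‖ ≤ ‖S x‖)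
    (hr : Module.finrank ℝ S.range = r) (hP : IsTopEigenProj r S' P) :
    ‖ranProj S - P‖ ≤ 4 / lam * ‖S' - S‖ := by
  classical
  obtain ⟨b, ev, hanti, hb, rfl⟩ := hP
  set ε := ‖S' - S‖ with hε
  set J : Set (Fin k) := {j : Fin k | (j : ℕ) < r} with hJ
  set P := (Submodule.span ℝ (b '' J)).starProjection with hPdef
  set Q := ranProj S with hQdef
  have hε0 : 0 ≤ ε := norm_nonneg _
  have hev0 : ∀ j, 0 ≤ ev j := fun j => by
    have := hpos (b j)
    rwa [hb, real_inner_smul_left, real_inner_self_eq_norm_sq, b.orthonormal.1, one_pow,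
      mul_one] at this
  have hdiff : ∀ x, ‖S' x - S x‖ ≤ ε * ‖x‖ := fun x => (S' - S).le_opNorm x
  have hcoord := b.inner_map_eigen hS' hb
  have hker : ∀ x ∈ S.rangeᗮ, S x = 0 := fun x hx => by
    refine inner_self_eq_zero (𝕜 := ℝ).1 ?_
    have h1 : inner ℝ (S x) (S x) = inner ℝ x (S (S x)) := hS x (S x)
    rw [h1, real_inner_comm]
    exact (Submodule.mem_orthogonal _ _).1 hx _ ⟨S x, rfl⟩
  have hrk : r + Module.finrank ℝ S.rangeᗮ = k := by
    have := Submodule.finrank_add_finrank_orthogonal S.range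
    rwa [hr, finrank_euclideanSpace_fin] at this
  -- Courant-Fischer: the first `j + 1` eigenvectors span a space that meets `ker S`, of dimension
  -- `k - r`, since `j ≥ r`. There `S'` has norm at most `ε`.
  have hsmall : ∀ j, j ∉ J → ev j ≤ ε := by
    intro j hj
    have hj' : r ≤ (j : ℕ) := not_lt.1 hj
    obtain ⟨x, hx0, hxU, hxV⟩ := exists_ne_zero_mem_inf (Submodule.span ℝ (b '' Iic j)) S.rangeᗮ
      (by rw [b.finrank_span_image, ← Nat.card_eq_fintype_card, Nat.card_eq_card_toFinset]; simp; omega)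
    have hx : 0 < ‖x‖ := norm_pos_iff.2 hx0
    have h1 : ev j * ‖x‖ ≤ ‖S' x‖ := by
      refine le_of_sq_le_sq ?_ (norm_nonneg _)
      rw [mul_pow, b.norm_sq_eq_sum_inner x, b.norm_sq_eq_sum_inner (S' x), Finset.mul_sum]
      refine Finset.sum_le_sum fun i _ => ?_
      rw [hcoord, mul_pow]
      by_cases hi : i ∈ Iic j
      · exact mul_le_mul_of_nonneg_right (pow_le_pow_left₀ (hev0 j) (hanti hi) 2) (sq_nonneg _)
      · rw [b.inner_eq_zero_of_mem_span hxU hi]; simp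
    have h2 := hdiff x
    rw [hker x hxV, sub_zero] at h2
    exact le_of_mul_le_mul_right (h1.trans h2) hx
  -- Dually, the span of the eigenvectors from `j` on has dimension `k - j` and meets `ran S`, since
  -- `j < r`.
  have hlarge : ∀ j ∈ J, lam - ε ≤ ev j := by
    intro j hj
    have hj' : (j : ℕ) < r := hj
    obtain ⟨x, hx0, hxU, hxV⟩ := exists_ne_zero_mem_inf (Submodule.span ℝ (b '' Ici j)) S.range
      (by rw [b.finrank_span_image, hr, ← Nat.card_eq_fintype_card,
        Nat.card_eq_card_toFinset]; simp; omega)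
    have hx : 0 < ‖x‖ := norm_pos_iff.2 hx0
    have h1 : ‖S' x‖ ≤ ev j * ‖x‖ := by
      refine le_of_sq_le_sq ?_ (mul_nonneg (hev0 j) hx.le)
      rw [mul_pow, b.norm_sq_eq_sum_inner x, b.norm_sq_eq_sum_inner (S' x), Finset.mul_sum]
      refine Finset.sum_le_sum fun i _ => ?_
      rw [hcoord, mul_pow]
      by_cases hi : i ∈ Ici j
      · exact mul_le_mul_of_nonneg_right (pow_le_pow_left₀ (hev0 i) (hanti hi) 2) (sq_nonneg _)
      · rw [b.inner_eq_zero_of_mem_span hxU hi]; simp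
    have h2 := hdiff x
    have h3 := hmin x hxV
    have h4 := norm_sub_norm_le (S x) (S' x)
    rw [norm_sub_rev] at h4
    refine le_of_mul_le_mul_right ?_ hx
    rw [sub_mul]
    linarith
  have hPcoord := b.inner_starProjection_span J
  have hQS : ∀ x, S (Q x) = S x := fun x => by
    have := hker (x - Q x) (Submodule.sub_starProjection_mem_orthogonal x)
    rw [map_sub, sub_eq_zero] at this
    exact this.symm
  have hQnorm : ∀ x, ‖Q x‖ ≤ ‖x‖ := fun x => Submodule.norm_starProjection_apply_le _ x
  have hPnorm : ∀ x, ‖P x‖ ≤ ‖x‖ := fun x => Submodule.norm_starProjection_apply_le _ x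
  have hQc : ∀ x, ‖x - Q x‖ ≤ ‖x‖ := fun x => by
    have := Submodule.norm_starProjection_apply_le S.rangeᗮ x
    rwa [Submodule.starProjection_orthogonal_val] at this
  have hPc : ∀ x, ‖x - P x‖ ≤ ‖x‖ := fun x => by
    have := Submodule.norm_starProjection_apply_le (Submodule.span ℝ (b '' J))ᗮ x
    rwa [Submodule.starProjection_orthogonal_val] at this
  -- `S'` is at most `ε` on `ran (1 - P)`, hence `S` is at most `2ε` there, while `S` is at least
  -- `lam` on `ran Q`.
  have hfirst : ∀ x, lam * ‖Q (x - P x)‖ ≤ 2 * ε * ‖x‖ := by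
    intro x
    have h1 : ‖S' (x - P x)‖ ≤ ε * ‖x - P x‖ := by
      refine le_of_sq_le_sq ?_ (mul_nonneg hε0 (norm_nonneg _))
      rw [mul_pow, b.norm_sq_eq_sum_inner (x - P x), b.norm_sq_eq_sum_inner (S' _),
        Finset.mul_sum]
      refine Finset.sum_le_sum fun i _ => ?_
      rw [hcoord, mul_pow]
      by_cases hi : i ∈ J
      · rw [inner_sub_right, hPcoord, if_pos hi]; simp
      · exact mul_le_mul_of_nonneg_right (pow_le_pow_left₀ (hev0 i) (hsmall i hi) 2) (sq_nonneg _)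
    have h2 := hmin _ (Submodule.starProjection_apply_mem S.range (x - P x))
    have h2' : lam * ‖Q (x - P x)‖ ≤ ‖S (x - P x)‖ := by rw [← hQS]; exact h2
    have h3 := hdiff (x - P x)
    have h4 := norm_sub_norm_le (S (x - P x)) (S' (x - P x))
    rw [norm_sub_rev] at h4
    have h5 := mul_le_mul_of_nonneg_left (hPc x) hε0
    linarith
  have hsecond : ∀ x, lam * ‖P (x - Q x)‖ ≤ 2 * ε * ‖x‖ := by
    intro x
    set z := x - Q x with hz
    have hSz : S z = 0 := by rw [hz, map_sub, hQS, sub_self]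
    -- When `lam ≤ ε` the claim is trivial, so no smallness of the perturbation is needed.
    have h1 : (lam - ε) * ‖P z‖ ≤ ‖S' z‖ := by
      rcases le_or_gt lam ε with hle | hlt
      · exact (mul_nonpos_of_nonpos_of_nonneg (by linarith) (norm_nonneg _)).trans (norm_nonneg _)
      refine le_of_sq_le_sq ?_ (norm_nonneg _)
      rw [mul_pow, b.norm_sq_eq_sum_inner (P z), b.norm_sq_eq_sum_inner (S' z), Finset.mul_sum]
      refine Finset.sum_le_sum fun i _ => ?_
      rw [hcoord, mul_pow, hPcoord]
      split_ifs with hi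
      · exact mul_le_mul_of_nonneg_right (pow_le_pow_left₀ (by linarith) (hlarge i hi) 2)
          (sq_nonneg _)
      · rw [zero_pow two_ne_zero, mul_zero]; positivity
    have h2 := hdiff z
    rw [hSz, sub_zero] at h2
    have h3 := mul_le_mul_of_nonneg_left (hQc x) hε0
    have h4 := mul_le_mul_of_nonneg_left ((hPnorm z).trans (hQc x)) hε0
    rw [sub_mul] at h1
    linarith
  -- `(1 - Q)P` is the adjoint of `P(1 - Q)`, so the previous bound transfers by duality.
  have hthird : ∀ x, lam * ‖P x - Q (P x)‖ ≤ 2 * ε * ‖x‖ := by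
    intro x
    set z := P x - Q (P x) with hz
    have hQz : Q z = 0 := by
      have : Q (Q (P x)) = Q (P x) := Submodule.starProjection_eq_self_iff.2
        (Submodule.starProjection_apply_mem S.range _)
      rw [hz, map_sub, this, sub_self]
    have h0 : inner ℝ z (Q (P x)) = 0 := by
      have : inner ℝ (Q z) (P x) = inner ℝ z (Q (P x)) :=
        Submodule.inner_starProjection_left_eq_right _ _ _
      rw [← this, hQz, inner_zero_left]
    have h1 : ‖z‖ ^ 2 = inner ℝ (P z) x := by
      have : inner ℝ (P z) x = inner ℝ z (P x) :=
        Submodule.inner_starProjection_left_eq_right _ _ _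
      rw [this, ← real_inner_self_eq_norm_sq]
      conv_lhs => rw [hz, ← hz, inner_sub_right, h0, sub_zero]
    have h2 := hsecond z
    rw [hQz, sub_zero] at h2
    rcases (norm_nonneg z).eq_or_lt with h3 | h3
    · rw [← h3, mul_zero]; positivity
    refine le_of_mul_le_mul_right ?_ h3
    calc lam * ‖z‖ * ‖z‖ = lam * inner ℝ (P z) x := by rw [← h1]; ring
      _ ≤ lam * (‖P z‖ * ‖x‖) := by gcongr; exact real_inner_le_norm _ _
      _ = lam * ‖P z‖ * ‖x‖ := by ring
      _ ≤ 2 * ε * ‖z‖ * ‖x‖ := by gcongr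
      _ = _ := by ring
  refine ContinuousLinearMap.opNorm_le_bound _ (by positivity) fun x => ?_
  -- The splitting `Q - P = Q(1 - P) - (1 - Q)P` costs `2ε/lam` for each term.
  have hdecomp : (Q - P) x = Q (x - P x) - (P x - Q (P x)) := by
    rw [map_sub, sub_apply]
    abel
  rw [hdecomp]
  refine (norm_sub_le _ _).trans ?_
  have h1 := hfirst x
  have h2 := hthird x
  rw [div_mul_eq_mul_div, div_mul_eq_mul_div, le_div_iff₀ hlam]
  linarith

/-- The nonzero eigenvalues of a symmetric operator bound it from below on its range. -/
theorem mul_norm_le_norm_map_of_mem_range {k : ℕ} {S : Euc k →L[ℝ] Euc k} (hS : S.IsSymmetric)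
    {lam : ℝ} (hlam : 0 ≤ lam)
    (hmin : ∀ l, l ≠ 0 → Module.End.HasEigenvalue S.toLinearMap l → lam ≤ |l|)
    {x : Euc k} (hx : x ∈ S.range) : lam * ‖x‖ ≤ ‖S x‖ := by
  obtain ⟨y, rfl⟩ := hx
  have hfin : Module.finrank ℝ (Euc k) = k := finrank_euclideanSpace_fin
  set b := hS.eigenvectorBasis hfin
  have hb : ∀ j, S (b j) = hS.eigenvalues hfin j • b j := fun j =>
    hS.apply_eigenvectorBasis hfin j
  have hcoord := b.inner_map_eigen hS hb
  refine le_of_sq_le_sq ?_ (norm_nonneg _)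
  change (lam * ‖S y‖) ^ 2 ≤ _
  rw [mul_pow, b.norm_sq_eq_sum_inner (S y), b.norm_sq_eq_sum_inner (S _), Finset.mul_sum]
  refine Finset.sum_le_sum fun i _ => ?_
  change lam ^ 2 * _ ≤ inner ℝ (b i) (S (S y)) ^ 2
  rw [hcoord (S y), mul_pow]
  -- A vector `S y` has no component along eigenvectors of eigenvalue zero.
  rcases eq_or_ne (hS.eigenvalues hfin i) 0 with h0 | h0
  · rw [hcoord y, h0]; simp
  · refine mul_le_mul_of_nonneg_right ?_ (sq_nonneg _)
    rw [← sq_abs (hS.eigenvalues hfin i)]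
    exact pow_le_pow_left₀ hlam (hmin _ h0 (hS.hasEigenvalue_eigenvalues hfin i)) 2

/-! ### Scalar sub-gaussian variables: exponential moments and Bernstein's inequality -/

section Scalar

variable {Ω : Type*} [MeasurableSpace Ω] {μ : Measure Ω}

/-- The moments of `f` grow like those of a sub-gaussian variable: `‖f‖_q ≤ a √q`, `q ≥ 1`. -/
def SubgaussMoments (f : Ω → ℝ) (a : ℝ) (μ : Measure Ω) : Prop :=
  ∀ q : ℝ, 1 ≤ q → eLpNorm f (ENNReal.ofReal q) μ ≤ ENNReal.ofReal (a * √q)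

theorem SubgaussMoments.lintegral_pow_le {f : Ω → ℝ} {a : ℝ} (ha : 0 ≤ a)
    (h : SubgaussMoments f a μ) {j : ℕ} (hj : j ≠ 0) :
    ∫⁻ ω, ENNReal.ofReal ((f ω ^ 2) ^ j) ∂μ ≤ ENNReal.ofReal ((2 * a ^ 2 * j) ^ j) := by
  have hj1 : (1 : ℝ) ≤ j := by exact_mod_cast Nat.one_le_iff_ne_zero.2 hj
  have hq : (0 : ℝ) < 2 * j := by linarith
  have h1 := h (2 * j) (by linarith)
  rw [eLpNorm_eq_lintegral_rpow_enorm_toReal (by simpa using hj) ENNReal.ofReal_ne_top,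
    ENNReal.toReal_ofReal hq.le, one_div] at h1
  have h2 := (ENNReal.rpow_inv_le_iff hq).1 h1
  calc ∫⁻ ω, ENNReal.ofReal ((f ω ^ 2) ^ j) ∂μ = ∫⁻ ω, ‖f ω‖ₑ ^ (2 * (j : ℝ)) ∂μ := by
        refine lintegral_congr fun ω => ?_
        rw [Real.enorm_eq_ofReal_abs, ENNReal.ofReal_rpow_of_nonneg (abs_nonneg _) hq.le,
          Real.rpow_mul (abs_nonneg _), Real.rpow_natCast]
        norm_num
    _ ≤ _ := h2
    _ = _ := by
        rw [ENNReal.ofReal_rpow_of_nonneg (by positivity) hq.le, Real.rpow_mul (by positivity),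
          Real.rpow_natCast]
        congr 2
        rw [Real.rpow_two, mul_pow, Real.sq_sqrt hq.le]
        ring

/-- In the exponential series the term of order `j` has expectation at most `(jʲ/j!) 6⁻ʲ ≤ (e/6)ʲ ≤
2⁻ʲ`; the geometric sum is 2. -/
theorem SubgaussMoments.lintegral_exp_sq_le [IsProbabilityMeasure μ] {f : Ω → ℝ} {a : ℝ}
    (ha : 0 < a) (hf : AEMeasurable f μ) (h : SubgaussMoments f a μ) :
    ∫⁻ ω, ENNReal.ofReal (Real.exp (f ω ^ 2 / (12 * a ^ 2))) ∂μ ≤ 2 := by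
  have hterm : ∀ ω, ENNReal.ofReal (Real.exp (f ω ^ 2 / (12 * a ^ 2))) =
      ∑' j : ℕ, ENNReal.ofReal ((f ω ^ 2) ^ j) *
        ENNReal.ofReal (((12 * a ^ 2) ^ j * (j.factorial : ℝ))⁻¹) := by
    intro ω
    rw [Real.exp_eq_exp_ℝ, NormedSpace.exp_eq_tsum_div, ENNReal.ofReal_tsum_of_nonneg
      (fun j => by positivity) (NormedSpace.expSeries_div_summable _)]
    refine tsum_congr fun j => ?_
    rw [← ENNReal.ofReal_mul (by positivity)]
    congr 1
    rw [div_pow]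
    field_simp
  have hbound : ∀ j : ℕ, ∫⁻ ω, ENNReal.ofReal ((f ω ^ 2) ^ j) *
      ENNReal.ofReal (((12 * a ^ 2) ^ j * (j.factorial : ℝ))⁻¹) ∂μ ≤ 2⁻¹ ^ j := by
    intro j
    rw [lintegral_mul_const'' _ (by fun_prop)]
    rcases Nat.eq_zero_or_pos j with rfl | hj
    · simp
    · calc _ ≤ ENNReal.ofReal ((2 * a ^ 2 * j) ^ j) *
            ENNReal.ofReal (((12 * a ^ 2) ^ j * (j.factorial : ℝ))⁻¹) := by
            gcongr; exact h.lintegral_pow_le ha.le hj.ne'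
        _ = ENNReal.ofReal ((j : ℝ) ^ j / j.factorial * (1 / 6) ^ j) := by
            rw [← ENNReal.ofReal_mul (by positivity)]
            congr 1
            rw [show (12 * a ^ 2 : ℝ) = 2 * a ^ 2 * 6 by ring, mul_pow (2 * a ^ 2 : ℝ) (j : ℝ),
              mul_pow (2 * a ^ 2 : ℝ) 6, one_div, inv_pow]
            field_simp
        _ ≤ ENNReal.ofReal ((1 / 2) ^ j) := by
            refine ENNReal.ofReal_le_ofReal ?_
            calc (j : ℝ) ^ j / j.factorial * (1 / 6) ^ j ≤ Real.exp j * (1 / 6) ^ j := by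
                  gcongr; exact Real.pow_div_factorial_le_exp _ (by positivity) j
              _ = (Real.exp 1 * (1 / 6)) ^ j := by
                  rw [mul_pow, ← Real.exp_nat_mul, mul_one]
              _ ≤ (1 / 2) ^ j := by
                  have := Real.exp_one_lt_d9
                  gcongr
                  linarith
        _ = 2⁻¹ ^ j := by
            rw [ENNReal.ofReal_pow (by norm_num), one_div, ENNReal.ofReal_inv_of_pos (by norm_num)]
            norm_num
  calc _ = ∑' j : ℕ, ∫⁻ ω, ENNReal.ofReal ((f ω ^ 2) ^ j) *
        ENNReal.ofReal (((12 * a ^ 2) ^ j * (j.factorial : ℝ))⁻¹) ∂μ := by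
        rw [← lintegral_tsum (fun j => by fun_prop)]
        exact lintegral_congr hterm
    _ ≤ ∑' j : ℕ, (2⁻¹ : ENNReal) ^ j := ENNReal.tsum_le_tsum hbound
    _ = 2 := by
        rw [ENNReal.tsum_geometric, ENNReal.one_sub_inv_two, inv_inv]

theorem SubgaussMoments.integrable_exp_sq [IsProbabilityMeasure μ] {f : Ω → ℝ} {a : ℝ}
    (ha : 0 < a) (hf : AEMeasurable f μ) (h : SubgaussMoments f a μ) :
    Integrable (fun ω => Real.exp (f ω ^ 2 / (12 * a ^ 2))) μ := by
  refine ⟨by fun_prop, ?_⟩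
  rw [hasFiniteIntegral_iff_ofReal (ae_of_all _ fun ω => (Real.exp_pos _).le)]
  exact (h.lintegral_exp_sq_le ha hf).trans_lt (by norm_num)

theorem SubgaussMoments.integral_exp_sq_le [IsProbabilityMeasure μ] {f : Ω → ℝ} {a : ℝ}
    (ha : 0 < a) (hf : AEMeasurable f μ) (h : SubgaussMoments f a μ) :
    ∫ ω, Real.exp (f ω ^ 2 / (12 * a ^ 2)) ∂μ ≤ 2 := by
  rw [integral_eq_lintegral_of_nonneg_ae (ae_of_all _ fun ω => (Real.exp_pos _).le) (by fun_prop)]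
  exact ENNReal.toReal_le_of_le_ofReal (by norm_num) (by
    simpa using h.lintegral_exp_sq_le ha hf)

theorem SubgaussMoments.memLp_two {f : Ω → ℝ} {a : ℝ} (hf : AEMeasurable f μ)
    (h : SubgaussMoments f a μ) : MemLp f 2 μ := by
  refine ⟨hf.aestronglyMeasurable, ?_⟩
  have := h 2 (by norm_num)
  rw [show ENNReal.ofReal 2 = 2 by norm_num] at this
  exact this.trans_lt ENNReal.ofReal_lt_top

theorem SubgaussMoments.integral_sq_le {f : Ω → ℝ} {a : ℝ} (ha : 0 ≤ a)
    (h : SubgaussMoments f a μ) (hf : AEMeasurable f μ) : ∫ ω, f ω ^ 2 ∂μ ≤ 2 * a ^ 2 := by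
  rw [integral_eq_lintegral_of_nonneg_ae (ae_of_all _ fun ω => sq_nonneg _) (by fun_prop)]
  refine ENNReal.toReal_le_of_le_ofReal (by positivity) ?_
  simpa using h.lintegral_pow_le ha one_ne_zero

/-- Sub-gaussian tails. -/
theorem SubgaussMoments.measure_le [IsProbabilityMeasure μ] {f : Ω → ℝ} {a : ℝ}
    (ha : 0 < a) (hf : AEMeasurable f μ) (h : SubgaussMoments f a μ) {r : ℝ} (hr : 0 ≤ r) :
    μ.real {ω | r ≤ |f ω|} ≤ 2 * Real.exp (-(r ^ 2 / (12 * a ^ 2))) := by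
  have h1 := mul_meas_ge_le_integral_of_nonneg (ae_of_all μ fun ω => (Real.exp_pos _).le)
    (h.integrable_exp_sq ha hf) (Real.exp (r ^ 2 / (12 * a ^ 2)))
  have h2 := h1.trans (h.integral_exp_sq_le ha hf)
  have hset : {ω | Real.exp (r ^ 2 / (12 * a ^ 2)) ≤ Real.exp (f ω ^ 2 / (12 * a ^ 2))} =
      {ω | r ≤ |f ω|} := by
    ext ω
    simp only [mem_ofPred_eq, Real.exp_le_exp]
    rw [div_le_div_iff_of_pos_right (by positivity), sq_le_sq, abs_of_nonneg hr]
  rw [hset] at h2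
  rw [Real.exp_neg, ← div_eq_mul_inv, le_div_iff₀ (Real.exp_pos _)]
  linarith

/-- The remainder satisfies `|eʸ - 1 - y| ≤ y² e^|y|` with `y = θx`. One factor `exp (x/(2K))`
absorbs `x²` and another absorbs `e^|y|`. -/
theorem Real.exp_mul_le_of_abs_le {K θ x : ℝ} (hK : 0 < K) (hθ : |θ| ≤ 1 / (2 * K))
    (hx : 0 ≤ x) :
    Real.exp (θ * x) ≤ 1 + θ * x + 8 * K ^ 2 * θ ^ 2 * Real.exp (x / K) := by
  have h1 : |Real.exp (θ * x) - 1 - θ * x| ≤ (θ * x) ^ 2 * Real.exp |θ * x| := by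
    have := Complex.norm_exp_sub_sum_le_norm_mul_exp ((θ * x : ℝ) : ℂ) 2
    simp only [Finset.sum_range_succ, Finset.range_zero, Finset.sum_empty, pow_zero, pow_one,
      Nat.factorial, Complex.norm_real, Real.norm_eq_abs, sq_abs] at this
    rw [← Complex.ofReal_exp] at this
    norm_num at this
    have h2 : ((Real.exp (θ * x) : ℝ) : ℂ) - (1 + (θ : ℂ) * x) =
        ((Real.exp (θ * x) - 1 - θ * x : ℝ) : ℂ) := by push_cast; ring
    rw [abs_mul]
    rw [← Complex.ofReal_mul, ← Complex.ofReal_exp] at this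
    rw [Complex.ofReal_mul, h2, Complex.norm_real, Real.norm_eq_abs] at this
    exact this
  have h2 : |θ * x| ≤ x / (2 * K) := by
    rw [abs_mul, abs_of_nonneg hx]
    calc |θ| * x ≤ 1 / (2 * K) * x := by gcongr
      _ = _ := by ring
  have h3 : x ^ 2 ≤ 8 * K ^ 2 * Real.exp (x / (2 * K)) := by
    have := Real.pow_div_factorial_le_exp (x / (2 * K)) (by positivity) 2
    rw [div_pow] at this
    norm_num [Nat.factorial] at this
    rw [div_div, div_le_iff₀ (by positivity)] at this
    linarith
  have h4 : Real.exp (x / K) = Real.exp (x / (2 * K)) * Real.exp (x / (2 * K)) := by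
    rw [← Real.exp_add]; congr 1; field_simp; norm_num
  have h5 : (θ * x) ^ 2 * Real.exp |θ * x| ≤ 8 * K ^ 2 * θ ^ 2 * Real.exp (x / K) := by
    calc (θ * x) ^ 2 * Real.exp |θ * x|
        ≤ θ ^ 2 * (8 * K ^ 2 * Real.exp (x / (2 * K))) * Real.exp (x / (2 * K)) := by
          rw [mul_pow]; gcongr
      _ = _ := by rw [h4]; ring
  have := le_abs_self (Real.exp (θ * x) - 1 - θ * x)
  linarith

theorem SubgaussMoments.integrable_exp_mul_sq [IsProbabilityMeasure μ] {f : Ω → ℝ} {a : ℝ}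
    (ha : 0 < a) (hf : AEMeasurable f μ) (h : SubgaussMoments f a μ) {θ : ℝ}
    (hθ : |θ| ≤ 1 / (2 * (12 * a ^ 2))) : Integrable (fun ω => Real.exp (θ * f ω ^ 2)) μ := by
  refine (h.integrable_exp_sq ha hf).mono' (by fun_prop) (ae_of_all _ fun ω => ?_)
  rw [Real.norm_eq_abs, Real.abs_exp, Real.exp_le_exp]
  calc θ * f ω ^ 2 ≤ 1 / (2 * (12 * a ^ 2)) * f ω ^ 2 := by
        gcongr; exact (le_abs_self _).trans hθ
    _ ≤ 1 / (12 * a ^ 2) * f ω ^ 2 := by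
        refine mul_le_mul_of_nonneg_right (one_div_le_one_div_of_le (by positivity) ?_)
          (sq_nonneg _)
        nlinarith [sq_pos_of_pos ha]
    _ = _ := by ring

/-- The first order term keeps the exact mean, so after centring only a quadratic term in `θ`
remains, as a Chernoff bound requires. -/
theorem SubgaussMoments.mgf_sq_le [IsProbabilityMeasure μ] {f : Ω → ℝ} {a : ℝ}
    (ha : 0 < a) (hf : AEMeasurable f μ) (h : SubgaussMoments f a μ) {θ : ℝ}
    (hθ : |θ| ≤ 1 / (2 * (12 * a ^ 2))) :
    mgf (fun ω => f ω ^ 2) μ θ ≤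
      Real.exp (θ * (∫ ω, f ω ^ 2 ∂μ) + 16 * (12 * a ^ 2) ^ 2 * θ ^ 2) := by
  have hsq := (h.memLp_two hf).integrable_sq
  have hexp := h.integrable_exp_sq ha hf
  have hi1 : Integrable (fun ω => 1 + θ * f ω ^ 2) μ := (integrable_const _).add (hsq.const_mul θ)
  have hi2 : Integrable (fun ω => 8 * (12 * a ^ 2) ^ 2 * θ ^ 2 *
    Real.exp (f ω ^ 2 / (12 * a ^ 2))) μ := hexp.const_mul _
  calc mgf (fun ω => f ω ^ 2) μ θ ≤ ∫ ω, (1 + θ * f ω ^ 2 +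
        8 * (12 * a ^ 2) ^ 2 * θ ^ 2 * Real.exp (f ω ^ 2 / (12 * a ^ 2))) ∂μ :=
        integral_mono (h.integrable_exp_mul_sq ha hf hθ) (hi1.add hi2) fun ω =>
          Real.exp_mul_le_of_abs_le (by positivity) hθ (sq_nonneg _)
    _ = 1 + θ * (∫ ω, f ω ^ 2 ∂μ) + 8 * (12 * a ^ 2) ^ 2 * θ ^ 2 *
          ∫ ω, Real.exp (f ω ^ 2 / (12 * a ^ 2)) ∂μ := by
        rw [integral_add hi1 hi2, integral_add (integrable_const _) (hsq.const_mul θ),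
          integral_const_mul, integral_const_mul]
        simp
    _ ≤ 1 + θ * (∫ ω, f ω ^ 2 ∂μ) + 8 * (12 * a ^ 2) ^ 2 * θ ^ 2 * 2 := by
        gcongr; exact h.integral_exp_sq_le ha hf
    _ = θ * (∫ ω, f ω ^ 2 ∂μ) + 16 * (12 * a ^ 2) ^ 2 * θ ^ 2 + 1 := by ring
    _ ≤ _ := Real.add_one_le_exp _

/-- Bernstein's inequality for the empirical second moment of a sub-gaussian variable. -/
theorem SubgaussMoments.measure_empirical_sq_le [IsProbabilityMeasure μ] {f : Ω → ℝ} {a : ℝ}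
    (ha : 0 < a) (hf : AEMeasurable f μ) (h : SubgaussMoments f a μ) {n : ℕ} (hn : 0 < n)
    {g : Fin n → Ω → ℝ} (hg : ∀ i, IdentDistrib (g i) f μ μ) (hind : iIndepFun g μ)
    {ε : ℝ} (hε : 0 ≤ ε) (hε' : ε ≤ 16 * (12 * a ^ 2)) :
    μ.real {ω | ε ≤ |(n : ℝ)⁻¹ * ∑ i, g i ω ^ 2 - ∫ ω, f ω ^ 2 ∂μ|} ≤
      2 * Real.exp (-(n * ε ^ 2 / (64 * (12 * a ^ 2) ^ 2))) := by
  set K := 12 * a ^ 2 with hK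
  have hK0 : 0 < K := by positivity
  have hn' : (0 : ℝ) < n := by exact_mod_cast hn
  set M := ∫ ω, f ω ^ 2 ∂μ with hM
  set Z : Fin n → Ω → ℝ := fun i ω => g i ω ^ 2 with hZ
  have hident : ∀ i, IdentDistrib (Z i) (fun ω => f ω ^ 2) μ μ := fun i =>
    (hg i).comp (measurable_id.pow_const 2)
  have hindZ : iIndepFun Z μ := hind.comp (fun _ x => x ^ 2) fun _ => measurable_id.pow_const 2
  have hmgf : ∀ θ, mgf (∑ i, Z i) μ θ = mgf (fun ω => f ω ^ 2) μ θ ^ n := fun θ => by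
    rw [hindZ.mgf_sum₀ (fun i => (hident i).aemeasurable_fst),
      Finset.prod_congr rfl fun i _ => mgf_congr_of_identDistrib _ _ (hident i) θ]
    simp
  -- A non-integrable exponential would have `mgf` equal to the default value 0, yet the product
  -- formula makes it positive.
  have hint : ∀ θ, |θ| ≤ 1 / (2 * K) → Integrable (fun ω => Real.exp (θ * (∑ i, Z i) ω)) μ := by
    intro θ hθ
    by_contra hno
    have h0 := mgf_undef hno
    rw [hmgf] at h0
    exact (pow_pos (mgf_pos (h.integrable_exp_mul_sq ha hf hθ)) n).ne' h0
  have hmgf_le : ∀ θ, |θ| ≤ 1 / (2 * K) → mgf (∑ i, Z i) μ θ ≤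
      Real.exp (n * (θ * M + 16 * K ^ 2 * θ ^ 2)) := by
    intro θ hθ
    rw [hmgf, Real.exp_nat_mul]
    exact pow_le_pow_left₀ mgf_nonneg (h.mgf_sq_le ha hf hθ) n
  -- This minimizes `16K²θ² - θε`, with value `-ε²/(64K²)`; the assumption `ε ≤ 16K` keeps `θ` in
  -- the admissible range.
  set θ := ε / (32 * K ^ 2) with hθdef
  have hθ0 : 0 ≤ θ := by positivity
  have hθ : |θ| ≤ 1 / (2 * K) := by
    rw [abs_of_nonneg hθ0, hθdef, div_le_div_iff₀ (by positivity) (by positivity)]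
    nlinarith
  have hexponent : 16 * K ^ 2 * θ ^ 2 - θ * ε = -(ε ^ 2 / (64 * K ^ 2)) := by
    rw [hθdef]; field_simp; ring
  have hup : μ.real {ω | n * (M + ε) ≤ (∑ i, Z i) ω} ≤
      Real.exp (-(n * ε ^ 2 / (64 * K ^ 2))) := by
    refine (measure_ge_le_exp_mul_mgf _ hθ0 (hint θ hθ)).trans ?_
    refine (mul_le_mul_of_nonneg_left (hmgf_le θ hθ) (Real.exp_pos _).le).trans (le_of_eq ?_)
    rw [← Real.exp_add]
    congr 1
    linear_combination n * hexponent
  have hlow : μ.real {ω | (∑ i, Z i) ω ≤ n * (M - ε)} ≤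
      Real.exp (-(n * ε ^ 2 / (64 * K ^ 2))) := by
    have hθ' : |(-θ)| ≤ 1 / (2 * K) := by rwa [abs_neg]
    refine (measure_le_le_exp_mul_mgf _ (neg_nonpos.2 hθ0) (hint _ hθ')).trans ?_
    refine (mul_le_mul_of_nonneg_left (hmgf_le _ hθ') (Real.exp_pos _).le).trans (le_of_eq ?_)
    rw [← Real.exp_add]
    congr 1
    linear_combination n * hexponent
  have hsub : {ω | ε ≤ |(n : ℝ)⁻¹ * ∑ i, g i ω ^ 2 - M|} ⊆
      {ω | n * (M + ε) ≤ (∑ i, Z i) ω} ∪ {ω | (∑ i, Z i) ω ≤ n * (M - ε)} := by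
    intro ω hω
    have hsum : (∑ i, Z i) ω = n * ((n : ℝ)⁻¹ * ∑ i, g i ω ^ 2) := by
      rw [Finset.sum_apply]; field_simp; rfl
    rcases le_abs.1 (mem_ofPred_eq ▸ hω : ε ≤ |_|) with h1 | h1
    · left
      change _ ≤ (∑ i, Z i) ω
      rw [hsum]
      gcongr
      linarith
    · right
      change (∑ i, Z i) ω ≤ _
      rw [hsum]
      gcongr
      linarith
  calc _ ≤ _ := measureReal_mono hsub (by finiteness)
    _ ≤ _ := measureReal_union_le _ _
    _ ≤ _ := by linarith

end Scalar

/-! ### Sub-gaussian vectors and union bounds over nets -/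

section Vector

variable {Ω : Type*} [MeasurableSpace Ω] {μ : Measure Ω} {k : ℕ}

theorem subgaussMoments_inner_of_psi2Norm_le {ξ : Ω → Euc k} {a : ℝ}
    (h : psi2Norm ξ μ ≤ ENNReal.ofReal a) (v : Euc k) :
    SubgaussMoments (fun ω => inner ℝ (ξ ω) v) (a * ‖v‖) μ := by
  intro q hq
  rcases eq_or_ne v 0 with rfl | hv
  · simp
  have hq0 : 0 < q := by linarith
  have hpos : 0 < ‖v‖ := norm_pos_iff.2 hv
  set w := ‖v‖⁻¹ • v with hw
  have hw1 : w ∈ Metric.sphere (0 : Euc k) 1 := by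
    rw [mem_sphere_zero_iff_norm, hw, norm_smul, norm_inv, norm_norm, inv_mul_cancel₀ hpos.ne']
  have hvw : (fun ω => inner ℝ (ξ ω) v) = ‖v‖ • fun ω => inner ℝ (ξ ω) w := by
    ext ω
    rw [Pi.smul_apply, hw, real_inner_smul_right, smul_eq_mul, mul_inv_cancel_left₀ hpos.ne']
  have h1 : ENNReal.ofReal (q ^ (-(1 / 2) : ℝ)) *
      eLpNorm (fun ω => inner ℝ (ξ ω) w) (ENNReal.ofReal q) μ ≤ ENNReal.ofReal a := by
    refine le_trans ?_ h
    unfold psi2Norm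
    refine le_trans ?_ (le_iSup₂ (f := fun v (_ : v ∈ Metric.sphere (0 : Euc k) 1) => _) w hw1)
    exact le_iSup₂ (f := fun q (_ : q ∈ Set.Ici (1 : ℝ)) => ENNReal.ofReal (q ^ (-(1 / 2) : ℝ)) *
      eLpNorm (fun ω => inner ℝ (ξ ω) w) (ENNReal.ofReal q) μ) q hq
  have hcancel : ENNReal.ofReal (√q) * ENNReal.ofReal (q ^ (-(1 / 2) : ℝ)) = 1 := by
    rw [← ENNReal.ofReal_mul (by positivity), Real.sqrt_eq_rpow, ← Real.rpow_add hq0]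
    simp
  have h2 : eLpNorm (fun ω => inner ℝ (ξ ω) w) (ENNReal.ofReal q) μ ≤
      ENNReal.ofReal (√q) * ENNReal.ofReal a := by
    calc _ = ENNReal.ofReal (√q) * (ENNReal.ofReal (q ^ (-(1 / 2) : ℝ)) *
        eLpNorm (fun ω => inner ℝ (ξ ω) w) (ENNReal.ofReal q) μ) := by
          rw [← mul_assoc, hcancel, one_mul]
      _ ≤ _ := by gcongr
  rw [hvw, eLpNorm_const_smul, enorm_norm, ← ofReal_norm]
  calc _ ≤ ENNReal.ofReal ‖v‖ * (ENNReal.ofReal (√q) * ENNReal.ofReal a) := by gcongr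
    _ = _ := by
      rw [← ENNReal.ofReal_mul (by positivity), ← ENNReal.ofReal_mul (by positivity)]
      congr 1
      ring

/-- Closes a union bound over a net with two-sided tails: `2 · 5ᵏ ≤ 10ᵏ ≤ e³ᵏ`, where `k ≥ 1`
absorbs the factor 2. -/
theorem five_pow_mul_exp_le {k : ℕ} (hk : 0 < k) {x τ : ℝ} (hx : 3 * (k + τ ^ 2) ≤ x) :
    5 ^ k * (2 * Real.exp (-x)) ≤ Real.exp (-τ ^ 2) := by
  have h1 : (2 : ℝ) ≤ 2 ^ k := by
    calc (2 : ℝ) = 2 ^ 1 := (pow_one _).symm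
      _ ≤ 2 ^ k := pow_le_pow_right₀ (by norm_num) hk
  have h10 : (10 : ℝ) ≤ Real.exp 3 := by
    have := Real.exp_one_gt_d9
    calc (10 : ℝ) ≤ 2.7 ^ 3 := by norm_num
      _ ≤ Real.exp 1 ^ 3 := by gcongr; linarith
      _ = Real.exp 3 := by rw [← Real.exp_nat_mul]; norm_num
  have h2 : (5 : ℝ) ^ k * 2 ≤ Real.exp (3 * k) := by
    calc (5 : ℝ) ^ k * 2 ≤ 5 ^ k * 2 ^ k := by gcongr
      _ = 10 ^ k := by rw [← mul_pow]; norm_num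
      _ ≤ Real.exp 3 ^ k := by gcongr
      _ = Real.exp (3 * k) := by rw [← Real.exp_nat_mul, mul_comm]
  calc 5 ^ k * (2 * Real.exp (-x)) = 5 ^ k * 2 * Real.exp (-x) := by ring
    _ ≤ Real.exp (3 * k) * Real.exp (-x) := by gcongr
    _ = Real.exp (3 * k - x) := by rw [← Real.exp_add]; congr 1
    _ ≤ _ := Real.exp_le_exp.2 (by nlinarith [sq_nonneg τ])

theorem measureReal_biUnion_le_card_mul [IsFiniteMeasure μ] {α : Type*} {N : Finset α}
    {B : α → Set Ω} {c δ : ℝ} (hc : (N.card : ℝ) ≤ c) (hδ : 0 ≤ δ)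
    (h : ∀ v ∈ N, μ.real (B v) ≤ δ) : μ.real (⋃ v ∈ N, B v) ≤ c * δ := by
  calc _ ≤ ∑ v ∈ N, μ.real (B v) := measureReal_biUnion_finset_le _ _
    _ ≤ ∑ _v ∈ N, δ := Finset.sum_le_sum h
    _ = N.card * δ := by simp
    _ ≤ _ := by gcongr

/-- Concentration of the norm of a projection of a sub-gaussian vector. -/
theorem measure_norm_starProjection_le [IsProbabilityMeasure μ] {ξ : Ω → Euc k}
    (hξ : AEMeasurable ξ μ) (h : psi2Norm ξ μ ≤ 1) (S : Submodule ℝ (Euc k)) {r : ℕ}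
    (hr : Module.finrank ℝ S = r) (hr0 : 0 < r) {τ : ℝ} (hτ : 0 ≤ τ) :
    μ.real {ω | 12 * (√r + τ) < ‖S.starProjection (ξ ω)‖} ≤ Real.exp (-τ ^ 2) := by
  obtain ⟨N, hN, h1, hnet⟩ := exists_net_norm_starProjection_le S
  rw [hr] at hN
  have hsg : ∀ v ∈ N, SubgaussMoments (fun ω => inner ℝ (ξ ω) v) 1 μ := fun v hv => by
    have := subgaussMoments_inner_of_psi2Norm_le (a := 1) (by simpa using h) v (μ := μ)
    rwa [h1 v hv, one_mul] at this
  -- The net loses a factor 2. The level `6(√r + τ)` gives the tail exponent `36(√r + τ)²/12 ≥ 3(r +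
  -- τ²)`.
  have hsub : {ω | 12 * (√r + τ) < ‖S.starProjection (ξ ω)‖} ⊆
      ⋃ v ∈ N, {ω | 6 * (√r + τ) ≤ |inner ℝ (ξ ω) v|} := by
    intro ω hω
    by_contra hno
    simp only [mem_iUnion, mem_ofPred_eq, not_exists, not_le] at hno
    have := hnet (ξ ω) (6 * (√r + τ)) (by positivity) fun v hv => (hno v hv).le
    have hω' : 12 * (√r + τ) < ‖S.starProjection (ξ ω)‖ := hω
    linarith
  refine (measureReal_mono hsub (measure_ne_top _ _)).trans ?_
  refine (measureReal_biUnion_le_card_mul (c := 5 ^ r) (by exact_mod_cast hN) (by positivity)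
    fun v hv => (hsg v hv).measure_le one_pos (by fun_prop) (by positivity)).trans ?_
  refine five_pow_mul_exp_le hr0 ?_
  have hsq := Real.sq_sqrt (Nat.cast_nonneg (α := ℝ) r)
  have := mul_nonneg (Real.sqrt_nonneg (r : ℝ)) hτ
  rw [le_div_iff₀ (by norm_num)]
  nlinarith

end Vector

/-! ### Covariance operators and their empirical versions -/

section Covariance

variable {Ω : Type*} [MeasurableSpace Ω] {μ : Measure Ω} {k : ℕ}

theorem memLp_two_of_psi2Norm_le {ξ : Ω → Euc k} (hξ : AEMeasurable ξ μ) {a : ℝ}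
    (h : psi2Norm ξ μ ≤ ENNReal.ofReal a) : MemLp ξ 2 μ := by
  rw [memLp_two_iff_integrable_sq_norm hξ.aestronglyMeasurable]
  have hsum : (fun ω => ‖ξ ω‖ ^ 2) =
      fun ω => ∑ i, inner ℝ (ξ ω) (EuclideanSpace.basisFun (Fin k) ℝ i) ^ 2 := by
    ext ω
    rw [(EuclideanSpace.basisFun (Fin k) ℝ).norm_sq_eq_sum_inner (ξ ω)]
    simp_rw [real_inner_comm]
  rw [hsum]
  refine integrable_finsetSum _ fun i _ => ?_
  exact ((subgaussMoments_inner_of_psi2Norm_le h _).memLp_two (by fun_prop)).integrable_sq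

theorem integrable_rankOne_self {ξ : Ω → Euc k} (hξ : MemLp ξ 2 μ) :
    Integrable (fun ω => InnerProductSpace.rankOne ℝ (ξ ω) (ξ ω)) μ := by
  refine (hξ.integrable_norm_pow two_ne_zero).mono' ?_ (ae_of_all _ fun ω => ?_)
  · have hcont : Continuous fun x : Euc k => InnerProductSpace.rankOne ℝ x x :=
      (InnerProductSpace.rankOne (𝕜 := ℝ) (E := Euc k) (F := Euc k)).continuous.clm_apply continuous_id
    exact hcont.comp_aestronglyMeasurable hξ.1
  · rw [InnerProductSpace.norm_rankOne, sq]

theorem inner_covOp {ξ : Ω → Euc k} (hξ : MemLp ξ 2 μ) (x y : Euc k) :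
    inner ℝ (covOp ξ μ x) y = ∫ ω, inner ℝ (ξ ω) x * inner ℝ (ξ ω) y ∂μ := by
  have hint := integrable_rankOne_self hξ
  rw [covOp, ContinuousLinearMap.integral_apply hint, real_inner_comm,
    ← integral_inner (hint.apply_continuousLinearMap x)]
  refine integral_congr_ae (ae_of_all _ fun ω => ?_)
  simp only [InnerProductSpace.rankOne_apply]
  rw [real_inner_smul_right, real_inner_comm (ξ ω) y]

theorem covOp_isSymmetric {ξ : Ω → Euc k} (hξ : MemLp ξ 2 μ) : (covOp ξ μ).IsSymmetric := by
  intro x y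
  change inner ℝ (covOp ξ μ x) y = inner ℝ x (covOp ξ μ y)
  rw [real_inner_comm _ x, inner_covOp hξ, inner_covOp hξ]
  simp_rw [mul_comm]

theorem inner_covOp_self {ξ : Ω → Euc k} (hξ : MemLp ξ 2 μ) (x : Euc k) :
    inner ℝ (covOp ξ μ x) x = ∫ ω, inner ℝ (ξ ω) x ^ 2 ∂μ := by
  simp_rw [inner_covOp hξ, sq]

/-- A square integrable random vector lies almost surely in the range of its covariance. -/
theorem ae_mem_range_covOp {ξ : Ω → Euc k} (hξ : MemLp ξ 2 μ) :
    ∀ᵐ ω ∂μ, ξ ω ∈ (covOp ξ μ).range := by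
  set V := (covOp ξ μ).range with hV
  -- For `w` orthogonal to the range, `E⟨ξ,w⟩² = ⟨Σw,w⟩ = 0`; a basis then reduces the claim to
  -- finitely many null sets.
  have hzero : ∀ w ∈ Vᗮ, ∀ᵐ ω ∂μ, inner ℝ (ξ ω) w = (0 : ℝ) := by
    intro w hw
    have h1 : ∫ ω, inner ℝ (ξ ω) w ^ 2 ∂μ = 0 := by
      rw [← inner_covOp_self hξ]
      exact (Submodule.mem_orthogonal _ _).1 hw _ ⟨w, rfl⟩
    rw [integral_eq_zero_iff_of_nonneg (fun ω => sq_nonneg _)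
      (hξ.inner_const w).integrable_sq] at h1
    filter_upwards [h1] with ω hω
    exact pow_eq_zero_iff two_ne_zero |>.1 hω
  have hall : ∀ᵐ ω ∂μ, ∀ i, inner ℝ (ξ ω)
      (Vᗮ.starProjection (EuclideanSpace.basisFun (Fin k) ℝ i)) = (0 : ℝ) :=
    ae_all_iff.2 fun i => hzero _ (Submodule.starProjection_apply_mem _ _)
  filter_upwards [hall] with ω hω
  have h0 : Vᗮ.starProjection (ξ ω) = 0 := by
    refine (EuclideanSpace.basisFun (Fin k) ℝ).repr.injective ?_
    ext i
    rw [OrthonormalBasis.repr_apply_apply, ← Submodule.inner_starProjection_left_eq_right,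
      real_inner_comm, hω, map_zero]
    rfl
  rw [Submodule.starProjection_orthogonal_val, sub_eq_zero] at h0
  exact Submodule.starProjection_eq_self_iff.1 h0.symm

/-- `Σ_AX = A Σ_X A*`, where `A*` is onto because `A` is injective, so the range is the injective
image of `ran Σ_X`. -/
theorem finrank_range_covOp_map {d m : ℕ} (A : Euc d →L[ℝ] Euc m) (hA : Function.Injective A)
    {X : Ω → Euc d} (hX : MemLp X 2 μ) :
    Module.finrank ℝ (covOp (fun ω => A (X ω)) μ).range =
      Module.finrank ℝ (covOp X μ).range := by
  have hAX : MemLp (fun ω => A (X ω)) 2 μ := A.comp_memLp' hX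
  have hcomp : ∀ z, covOp (fun ω => A (X ω)) μ z = A (covOp X μ (A.adjoint z)) := by
    intro z
    refine ext_inner_right ℝ fun y => ?_
    rw [inner_covOp hAX, ← ContinuousLinearMap.adjoint_inner_right A, inner_covOp hX]
    simp_rw [ContinuousLinearMap.adjoint_inner_right]
  have hsurj : Function.Surjective A.adjoint := fun x =>
    ⟨A ((A.adjoint ∘L A).inverse x), (gram_isInvertible A hA).self_apply_inverse x⟩
  have hrange : (covOp (fun ω => A (X ω)) μ).range =
      (covOp X μ).range.map A.toLinearMap := by
    ext y
    constructor
    · rintro ⟨z, rfl⟩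
      exact ⟨_, ⟨A.adjoint z, rfl⟩, (hcomp z).symm⟩
    · rintro ⟨_, ⟨x, rfl⟩, rfl⟩
      obtain ⟨z, rfl⟩ := hsurj x
      exact ⟨z, hcomp z⟩
  rw [hrange]
  exact ((covOp X μ).range.equivMapOfInjective A.toLinearMap hA).finrank_eq.symm

theorem inner_empCovOp {n : ℕ} (y : Fin n → Euc k) (x z : Euc k) :
    inner ℝ (empCovOp y x) z = (n : ℝ)⁻¹ * ∑ i, inner ℝ (y i) x * inner ℝ (y i) z := by
  simp only [empCovOp, smul_apply, sum_apply,
    InnerProductSpace.rankOne_apply, real_inner_smul_left, sum_inner]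

theorem empCovOp_isSymmetric {n : ℕ} (y : Fin n → Euc k) : (empCovOp y).IsSymmetric := by
  intro x z
  change inner ℝ (empCovOp y x) z = inner ℝ x (empCovOp y z)
  rw [real_inner_comm _ x, inner_empCovOp, inner_empCovOp]
  simp_rw [mul_comm]

theorem inner_empCovOp_self {n : ℕ} (y : Fin n → Euc k) (x : Euc k) :
    inner ℝ (empCovOp y x) x = (n : ℝ)⁻¹ * ∑ i, inner ℝ (y i) x ^ 2 := by
  simp_rw [inner_empCovOp, sq]

/-- Concentration of the empirical covariance of a sub-gaussian vector `Y` around an operator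
close to the covariance of `Y`. -/
theorem measure_norm_empCovOp_sub_le [IsProbabilityMeasure μ] (hk : 0 < k) {n : ℕ}
    {Y : Ω → Euc k} (hY : AEMeasurable Y μ)
    (hsg : ∀ v : Euc k, ‖v‖ = 1 → SubgaussMoments (fun ω => inner ℝ (Y ω) v) 2 μ)
    {Ys : Fin n → Ω → Euc k} (hident : ∀ i, IdentDistrib (Ys i) Y μ μ) (hind : iIndepFun Ys μ)
    {S : Euc k →L[ℝ] Euc k} (hS : S.IsSymmetric) {η : ℝ} (hη : 0 ≤ η)
    (hSY : ∀ v : Euc k, ‖v‖ = 1 →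
      |∫ ω, inner ℝ (Y ω) v ^ 2 ∂μ - inner ℝ (S v) v| ≤ η)
    {τ : ℝ} (hτ : 0 < τ) (hn : (√k + τ) ^ 2 ≤ n) :
    μ.real {ω | 32 * (672 * ((√k + τ) / √n) + η) < ‖empCovOp (fun i => Ys i ω) - S‖} ≤
      Real.exp (-τ ^ 2) := by
  have hk0 := Real.sqrt_nonneg (k : ℝ)
  have hn0 : (0 : ℝ) < n := lt_of_lt_of_le (by positivity) hn
  have hsn : 0 < √(n : ℝ) := Real.sqrt_pos.2 hn0
  -- With `a = 2` the scale is `K = 48`. The constant 672 keeps `ε ≤ 16K = 768` and makes the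
  -- exponent `672²/(64K²) = 3.0625` times `(√k + τ)²`, enough for the net.
  set ε := 672 * ((√k + τ) / √n) with hε
  have hε0 : 0 ≤ ε := by positivity
  have hε1 : ε ≤ 16 * (12 * 2 ^ 2) := by
    have : (√k + τ) / √n ≤ 1 := by
      rw [div_le_one hsn]
      exact Real.le_sqrt_of_sq_le hn
    rw [hε]
    linarith
  obtain ⟨N, hN, h1, hnet⟩ := exists_net_norm_symmetric_le k
  have hsub : {ω | 32 * (ε + η) < ‖empCovOp (fun i => Ys i ω) - S‖} ⊆
      ⋃ v ∈ N, {ω | ε ≤ |(n : ℝ)⁻¹ * ∑ i, inner ℝ (Ys i ω) v ^ 2 -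
        ∫ ω, inner ℝ (Y ω) v ^ 2 ∂μ|} := by
    intro ω hω
    by_contra hno
    simp only [mem_iUnion, mem_ofPred_eq, not_exists, not_le] at hno
    have hsym : (empCovOp (fun i => Ys i ω) - S).IsSymmetric :=
      (empCovOp_isSymmetric fun i => Ys i ω).sub hS
    have := hnet (empCovOp (fun i => Ys i ω) - S) (ε + η) hsym (by positivity) fun v hv => by
      rw [sub_apply, inner_sub_left, inner_empCovOp_self]
      have h2 := (hno v hv).le
      have h3 := hSY v (h1 v hv)
      rw [abs_le] at h2 h3 ⊢
      constructor <;> linarith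
    have hω' : 32 * (ε + η) < ‖empCovOp (fun i => Ys i ω) - S‖ := hω
    linarith
  refine (measureReal_mono hsub (measure_ne_top _ _)).trans ?_
  have hmeas : ∀ v : Euc k, Measurable fun y : Euc k => (inner ℝ y v : ℝ) := fun v => by fun_prop
  refine (measureReal_biUnion_le_card_mul (c := 5 ^ k) (by exact_mod_cast hN) (by positivity)
    fun v hv => (hsg v (h1 v hv)).measure_empirical_sq_le two_pos (by fun_prop)
      (by exact_mod_cast hn0) (g := fun i ω => inner ℝ (Ys i ω) v)
      (fun i => (hident i).comp (hmeas v))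
      (hind.comp (fun _ y => inner ℝ y v) fun _ => hmeas v) hε0 hε1).trans ?_
  refine five_pow_mul_exp_le hk ?_
  have hsq := Real.sq_sqrt (Nat.cast_nonneg (α := ℝ) k)
  have hmul := mul_nonneg hk0 hτ.le
  have hnε : n * ε ^ 2 = 672 ^ 2 * (√k + τ) ^ 2 := by
    rw [hε, mul_pow, div_pow, Real.sq_sqrt hn0.le]
    field_simp
  rw [hnε, le_div_iff₀ (by norm_num)]
  nlinarith

end Covariance

/-! ### The model `Y = AX + σW` and its perturbation terms -/

section Model

variable {Ω : Type*} [MeasurableSpace Ω] {μ : Measure Ω} {d m : ℕ}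

/-- Minkowski's inequality: the signal contributes at most `‖A*v‖ ≤ 1` and the noise at most `σ/√2 ≤
1`. -/
theorem subgaussMoments_model {A : Euc d →L[ℝ] Euc m} (hA : ‖A‖ ≤ 1)
    {X : Ω → Euc d} {W : Ω → Euc m} (hX : AEMeasurable X μ) (hW : AEMeasurable W μ)
    (hXψ : psi2Norm X μ ≤ ENNReal.ofReal 1) (hWψ : psi2Norm W μ ≤ ENNReal.ofReal (1 / √2))
    {σ : ℝ} (hσ : 0 ≤ σ) (hσ2 : σ ≤ √2) {v : Euc m} (hv : ‖v‖ = 1) :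
    SubgaussMoments (fun ω => inner ℝ (A (X ω) + σ • W ω) v) 2 μ := by
  intro q hq
  have h1 := subgaussMoments_inner_of_psi2Norm_le hXψ (A.adjoint v) q hq
  have h2 := subgaussMoments_inner_of_psi2Norm_le hWψ (σ • v) q hq
  have hadj : ‖A.adjoint v‖ ≤ 1 := by
    calc ‖A.adjoint v‖ ≤ ‖A.adjoint‖ * ‖v‖ := A.adjoint.le_opNorm v
      _ ≤ 1 := by rw [hv, mul_one, LinearIsometryEquiv.norm_map]; exact hA
  have hsv : 1 / √2 * ‖σ • v‖ ≤ 1 := by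
    rw [norm_smul, hv, mul_one, Real.norm_eq_abs, abs_of_nonneg hσ, one_div_mul_eq_div]
    exact (div_le_one (by positivity)).2 hσ2
  have hsplit : (fun ω => inner ℝ (A (X ω) + σ • W ω) v) =
      (fun ω => inner ℝ (X ω) (A.adjoint v)) + fun ω => (inner ℝ (W ω) (σ • v) : ℝ) := by
    ext ω
    rw [Pi.add_apply, inner_add_left, ContinuousLinearMap.adjoint_inner_right,
      real_inner_smul_left, real_inner_smul_right]
  rw [hsplit]
  refine (eLpNorm_add_le (by fun_prop) (by fun_prop) (by simpa using hq)).trans ?_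
  refine (add_le_add h1 h2).trans ?_
  rw [← ENNReal.ofReal_add (by positivity) (by positivity)]
  refine ENNReal.ofReal_le_ofReal ?_
  rw [← add_mul]
  gcongr
  linarith

/-- Independence and `E W = 0` remove the cross term, leaving `σ² E⟨W,v⟩²`, and `E⟨W,v⟩² ≤ 2(1/√2)²
= 1`. -/
theorem abs_integral_sq_model_sub_le [IsProbabilityMeasure μ] {A : Euc d →L[ℝ] Euc m}
    {X : Ω → Euc d} {W : Ω → Euc m} (hX : MemLp X 2 μ) (hW : AEMeasurable W μ)
    (hWψ : psi2Norm W μ ≤ ENNReal.ofReal (1 / √2)) (hW0 : ∫ ω, W ω ∂μ = 0)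
    (hind : IndepFun X W μ) {σ : ℝ} {v : Euc m} (hv : ‖v‖ = 1) :
    |∫ ω, inner ℝ (A (X ω) + σ • W ω) v ^ 2 ∂μ -
      inner ℝ (covOp (fun ω => A (X ω)) μ v) v| ≤ σ ^ 2 := by
  have hAX : MemLp (fun ω => A (X ω)) 2 μ := A.comp_memLp' hX
  have hW2 := memLp_two_of_psi2Norm_le hW hWψ
  have hx := hAX.inner_const (𝕜 := ℝ) v
  have hw := hW2.inner_const (𝕜 := ℝ) v
  have hind' : IndepFun (fun ω => (inner ℝ (A (X ω)) v : ℝ)) (fun ω => inner ℝ (W ω) v) μ :=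
    hind.comp (φ := fun x => inner ℝ (A x) v) (ψ := fun w => inner ℝ w v)
      (by fun_prop) (by fun_prop)
  have hcross : ∫ ω, inner ℝ (A (X ω)) v * inner ℝ (W ω) v ∂μ = 0 := by
    rw [hind'.integral_fun_mul_eq_mul_integral hx.1 hw.1]
    have : ∫ ω, inner ℝ (W ω) v ∂μ = 0 := by
      simp_rw [real_inner_comm v]
      rw [integral_inner (hW2.integrable one_le_two), hW0, inner_zero_right]
    rw [this, mul_zero]
  have hexpand : ∀ ω, inner ℝ (A (X ω) + σ • W ω) v ^ 2 = inner ℝ (A (X ω)) v ^ 2 +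
      2 * σ * (inner ℝ (A (X ω)) v * inner ℝ (W ω) v) + σ ^ 2 * inner ℝ (W ω) v ^ 2 := by
    intro ω
    rw [inner_add_left, real_inner_smul_left]
    ring
  have hi1 := hx.integrable_sq
  have hi2 : Integrable (fun ω => 2 * σ * (inner ℝ (A (X ω)) v * inner ℝ (W ω) v)) μ :=
    (hx.integrable_mul hw).const_mul (2 * σ)
  have hi3 := hw.integrable_sq.const_mul (σ ^ 2)
  have hvar : ∫ ω, inner ℝ (W ω) v ^ 2 ∂μ ≤ 1 := by
    have := (subgaussMoments_inner_of_psi2Norm_le hWψ v).integral_sq_le (by positivity)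
      (by fun_prop)
    rw [hv, mul_one, div_pow, Real.sq_sqrt zero_le_two] at this
    norm_num at this
    exact this
  have hvar0 : 0 ≤ ∫ ω, inner ℝ (W ω) v ^ 2 ∂μ := integral_nonneg fun ω => sq_nonneg _
  simp_rw [hexpand]
  rw [integral_add (hi1.fun_add hi2) hi3, integral_add hi1 hi2, integral_const_mul,
    integral_const_mul, hcross, inner_covOp_self hAX, mul_zero, add_zero, add_sub_cancel_left,
    abs_of_nonneg (by positivity)]
  nlinarith [sq_nonneg σ]

end Model

/-- The expanded perturbation terms are dominated by `boundB`. -/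
theorem perturbation_terms_le_boundB {m h n : ℕ} (hhm : h ≤ m) {lam τ σ : ℝ} (hlam : 0 < lam)
    (hτ : 0 < τ) (hσ : 0 < σ) (hσ2 : σ ≤ √2) :
    1 / lam * ((√m + τ) / √n + σ ^ 2) * ((√h + τ) + σ * (√m + τ)) + σ * (√h + τ) ≤
      3 * boundB m h n lam τ σ := by
  have hHM : √(h : ℝ) ≤ √m := Real.sqrt_le_sqrt (by exact_mod_cast hhm)
  have hM2 : (m : ℝ) = √m * √m := (Real.mul_self_sqrt (Nat.cast_nonneg m)).symm
  have hσ3 : σ ≤ 2 := hσ2.trans (by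
    rw [Real.sqrt_le_left (by norm_num)]; norm_num)
  unfold boundB
  rw [Real.sqrt_div (by positivity), Real.sqrt_mul (by positivity), Real.sqrt_div (by positivity)]
  have hmdiv : (m : ℝ) / √n = √m * √m * (√n)⁻¹ := by rw [← hM2, div_eq_mul_inv]
  rw [hmdiv]
  simp only [div_eq_mul_inv, one_mul]
  set H := √(h : ℝ)
  set M := √(m : ℝ)
  set R := (√(n : ℝ))⁻¹
  set L := lam⁻¹
  have hH : 0 ≤ H := Real.sqrt_nonneg _
  have hM : 0 ≤ M := Real.sqrt_nonneg _
  have hR : 0 ≤ R := inv_nonneg.2 (Real.sqrt_nonneg _)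
  have hL : 0 ≤ L := inv_nonneg.2 hlam.le
  -- After expansion only three monomials are absent from `boundB`; `H ≤ M` and `σ ≤ 2` fold them
  -- into present ones, and no coefficient then exceeds 3.
  have e1 : L * R * τ * H ≤ L * R * τ * M := by gcongr
  have e2 : L * R * τ ^ 2 * σ ≤ L * R * τ ^ 2 * 2 := by gcongr
  have e3 : L * σ ^ 2 * τ * σ ≤ L * σ ^ 2 * τ * 2 := by gcongr
  have p1 : 0 ≤ L * R * M * H := by positivity
  have p2 : 0 ≤ L * R * τ * M := by positivity
  have p3 : 0 ≤ σ * L * R * M * M := by positivity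
  have p4 : 0 ≤ σ * τ * L * R * M := by positivity
  have p5 : 0 ≤ L * R * τ ^ 2 := by positivity
  have p6 : 0 ≤ L * σ ^ 2 * H := by positivity
  have p7 : 0 ≤ L * σ ^ 2 * τ := by positivity
  have p8 : 0 ≤ L * σ ^ 3 * M := by positivity
  have p9 : 0 ≤ σ * H := by positivity
  have p10 : 0 ≤ σ * τ := by positivity
  nlinarith

/-- Since the projection fixes `A x`, the error is `(Π - P)y - σΠw`. Unprojected noise is multiplied
by the small `‖Π - P‖`; the remaining noise is seen only through `S`. -/
theorem norm_map_sub_topProj_le {d m : ℕ} {A : Euc d →L[ℝ] Euc m} (hA : ‖A‖ ≤ 1)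
    {S : Submodule ℝ (Euc m)} {P : Euc m →L[ℝ] Euc m} {x : Euc d} {w : Euc m} {σ : ℝ}
    (hσ : 0 ≤ σ) (hx : A x ∈ S) :
    ‖A x - P (A x + σ • w)‖ ≤
      ‖S.starProjection - P‖ * (‖x‖ + σ * ‖w‖) + σ * ‖S.starProjection w‖ := by
  have hAx : ‖A x‖ ≤ ‖x‖ := (A.le_opNorm x).trans (mul_le_of_le_one_left (norm_nonneg _) hA)
  have hdecomp : A x - P (A x + σ • w) =
      (S.starProjection - P) (A x + σ • w) - σ • S.starProjection w := by
    rw [sub_apply, map_add S.starProjection, map_smul S.starProjection,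
      Submodule.starProjection_eq_self_iff.2 hx]
    abel
  rw [hdecomp]
  refine (norm_sub_le _ _).trans ?_
  rw [norm_smul, Real.norm_eq_abs, abs_of_nonneg hσ]
  gcongr
  refine ((S.starProjection - P).le_opNorm _).trans ?_
  gcongr
  refine (norm_add_le _ _).trans ?_
  rw [norm_smul, Real.norm_eq_abs, abs_of_nonneg hσ]
  gcongr

end

/-! ### Assembly of the deterministic and probabilistic bounds -/

theorem theorem3p6 :
    -- absolute constants: `c` in the sample size condition, `C` in the final bound
    ∃ c > (0 : ℝ), ∃ C > (0 : ℝ),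
    ∀ {Ω : Type*} [MeasurableSpace Ω] (μ : Measure Ω) [IsProbabilityMeasure μ]
      (d m h n : ℕ) [NeZero d] (σ τ : ℝ)
      -- the inverse problem `Y = A X + σ W`
      (A : Euc d →L[ℝ] Euc m) (_ : Function.Injective A) (_ : ‖A‖ = 1)
      (X : Ω → Euc d) (W : Ω → Euc m) (_ : Measurable X) (_ : Measurable W)
      (_ : psi2Norm X μ = 1)
      (_ : psi2Norm W μ = ENNReal.ofReal (1 / √2)) (_ : ∫ ω, W ω ∂μ = 0)
      (_ : IndepFun X W μ) (_ : 0 < σ) (_ : σ < √2)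
      (_ : Module.finrank ℝ (covOp X μ).range = h)
      (Y : Ω → Euc m) (_ : ∀ ω, Y ω = A (X ω) + σ • W ω)
      -- the training set
      (Xs : Fin n → Ω → Euc d) (Ws : Fin n → Ω → Euc m) (Ys : Fin n → Ω → Euc m)
      (_ : ∀ i, IdentDistrib (fun ω => (Xs i ω, Ws i ω)) (fun ω => (X ω, W ω)) μ μ)
      (_ : ∀ i ω, Ys i ω = A (Xs i ω) + σ • Ws i ω)
      (_ : iIndepFun Ys μ)
      -- the singular value decomposition, the index `p`, and `λ_min`
      (u : Fin d → Euc m) (v : Fin d → Euc d) (s : Fin d → ℝ) (_ : IsSVD A u v s)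
      (p : Fin d)
      (_ : IsGreatest {i | ranProj (covOp (fun ω => A (X ω)) μ) (u i) ≠ 0} p)
      (lam : ℝ)
      (_ : IsLeast {l : ℝ | l ≠ 0 ∧ Module.End.HasEigenvalue
        (covOp (fun ω => A (X ω)) μ).toLinearMap l} lam)
      -- the conditions on `τ`, `n` and `σ`
      (_ : 0 < τ)
      (_ : c * ((√m + τ) ^ 2 * max (64 / lam ^ 2) 1) ≤ n) (_ : σ ^ 2 < lam / 8),
      (∀ ω, DifferentiableOn ℝ (tikhonov A (Y ω)) (Icc 0 1)) ∧
      ∃ E : Set Ω, MeasurableSet E ∧ 1 - 10 * Real.exp (-τ ^ 2) < μ.real E ∧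
        ∀ ω ∈ E, ∀ P : Euc m →L[ℝ] Euc m,
          IsTopEigenProj h (empCovOp fun i => Ys i ω) P →
          ∀ t ∈ Icc (0 : ℝ) 1,
            |empDerivFun A P (Y ω) t - derivFun A (Y ω) (X ω) t| ≤
              C * (boundB m h n lam τ σ *
                (1 / s p ^ 3 * (√h + τ) + σ / s ⊤ ^ 4 * (√d + τ))) := by
  -- With `c = 1` the sample condition yields `(√m + τ)² ≤ n`, as Bernstein's inequality needs. The
  -- final constant is `12 · 86016 · 3 · 12 = 37158912`, where `86016 = 4 · 32 · 672`.
  refine ⟨1, one_pos, 10 ^ 9, by positivity, ?_⟩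
  intro Ω _ μ _ d m h n _ σ τ A hA hA1 X W hX hW hXψ hWψ hW0 hXW hσ hσ2 hh Y hY Xs Ws Ys hident
    hYs hind u v s hs p hp lam hlam hτ hn _
  set S := covOp (fun ω => A (X ω)) μ with hSdef
  have hXψ1 : psi2Norm X μ ≤ ENNReal.ofReal 1 := by rw [hXψ]; simp
  have hX2 : MemLp X 2 μ := memLp_two_of_psi2Norm_le hX.aemeasurable hXψ1
  have hAX2 : MemLp (fun ω => A (X ω)) 2 μ := A.comp_memLp' hX2
  have hWψ1 : psi2Norm W μ ≤ 1 := by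
    rw [hWψ, ← ENNReal.ofReal_one]
    refine ENNReal.ofReal_le_ofReal ?_
    rw [div_le_one (by positivity)]
    exact Real.one_le_sqrt.2 (by norm_num)
  have hSsym : S.IsSymmetric := covOp_isSymmetric hAX2
  have hSrank : Module.finrank ℝ S.range = h := (finrank_range_covOp_map A hA hX2).trans hh
  have hY' : Y = fun ω => A (X ω) + σ • W ω := funext hY
  obtain ⟨⟨hlam0, hlamev⟩, hlammin⟩ := hlam
  obtain ⟨z, hz⟩ := hlamev.exists_hasEigenvector
  have hSz : S z = lam • z := hz.apply_eq_smul
  have hlampos : 0 < lam := by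
    refine lt_of_le_of_ne ?_ hlam0.symm
    have h1 : 0 ≤ inner ℝ (S z) z := by
      rw [inner_covOp_self hAX2]
      exact integral_nonneg fun ω => sq_nonneg _
    rw [hSz, real_inner_smul_left, real_inner_self_eq_norm_sq] at h1
    exact nonneg_of_mul_nonneg_left h1 (pow_pos (norm_pos_iff.2 hz.2) 2)
  have hh0 : 0 < h := by
    rw [← hSrank]
    have hmem : (⟨S z, ⟨z, rfl⟩⟩ : S.range) ≠ 0 := fun h0 => by
      have h1 : S z = 0 := congrArg Subtype.val h0
      rw [hSz] at h1
      exact (smul_ne_zero hlam0 hz.2) h1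
    exact Module.finrank_pos_iff_exists_ne_zero.2 ⟨_, hmem⟩
  have hhm : h ≤ m := by
    rw [← hSrank]
    exact (Submodule.finrank_le _).trans (by simp)
  have hm0 : 0 < m := hh0.trans_le hhm
  have hSmin : ∀ x ∈ S.range, lam * ‖x‖ ≤ ‖S x‖ := fun x hx =>
    mul_norm_le_norm_map_of_mem_range hSsym hlampos.le
      (fun l hl0 hl => (hlammin ⟨hl0, hl⟩).trans (le_abs_self l)) hx
  have hn' : (√m + τ) ^ 2 ≤ n := by
    rw [one_mul] at hn
    refine le_trans ?_ hn
    exact le_mul_of_one_le_right (sq_nonneg _) (le_max_right _ _)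
  refine ⟨fun ω t ht => (hs.hasDerivWithinAt_tikhonov hA (Y ω) ht).differentiableWithinAt, ?_⟩
  have hpair : Measurable fun q : Euc d × Euc m => A q.1 + σ • q.2 := by fun_prop
  have hYident : ∀ i, IdentDistrib (Ys i) Y μ μ := fun i => by
    have h1 := (hident i).comp hpair
    have h2 : Ys i = (fun q : Euc d × Euc m => A q.1 + σ • q.2) ∘ fun ω => (Xs i ω, Ws i ω) :=
      funext (hYs i)
    rw [h2, hY']
    exact h1
  have hYm : Measurable Y := by rw [hY']; fun_prop
  have hrangeA : Module.finrank ℝ A.range = d := by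
    rw [LinearMap.finrank_range_of_inj hA, finrank_euclideanSpace_fin]
  have hd0 : 0 < d := Nat.pos_of_ne_zero (NeZero.ne d)
  -- `X` is projected on `ran Σ_X`, where it lies almost surely, so that `‖X‖` is controlled by `√h`
  -- instead of `√d`.
  have b1 := measure_norm_starProjection_le hX.aemeasurable (by rw [hXψ])
    (covOp X μ).range hh hh0 hτ.le
  have b2 := measure_norm_starProjection_le hW.aemeasurable hWψ1 S.range hSrank hh0 hτ.le
  have b3 := measure_norm_starProjection_le hW.aemeasurable hWψ1 A.range hrangeA hd0 hτ.le
  have b4 := measure_norm_starProjection_le hW.aemeasurable hWψ1 ⊤ (r := m) (by simp) hm0 hτ.le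
  have b5 := measure_norm_empCovOp_sub_le hm0 hYm.aemeasurable
    (fun v hv => by
      rw [hY']
      exact subgaussMoments_model hA1.le hX.aemeasurable hW.aemeasurable hXψ1 hWψ.le hσ.le
        hσ2.le hv) hYident hind hSsym (sq_nonneg σ)
    (fun v hv => by
      rw [hY']
      exact abs_integral_sq_model_sub_le hX2 hW.aemeasurable hWψ.le hW0 hXW hv) hτ hn'
  have b6 : μ.real {ω | ¬ (X ω ∈ (covOp X μ).range ∧ A (X ω) ∈ S.range)} = 0 := by
    have := (ae_mem_range_covOp hX2).and (ae_mem_range_covOp hAX2)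
    rw [measureReal_def, ae_iff.1 this, ENNReal.toReal_zero]
  set B1 := {ω | 12 * (√h + τ) < ‖(covOp X μ).range.starProjection (X ω)‖}
  set B2 := {ω | 12 * (√h + τ) < ‖S.range.starProjection (W ω)‖}
  set B3 := {ω | 12 * (√d + τ) < ‖A.range.starProjection (W ω)‖}
  set B4 := {ω | 12 * (√m + τ) < ‖(⊤ : Submodule ℝ (Euc m)).starProjection (W ω)‖}
  set B5 := {ω | 32 * (672 * ((√m + τ) / √n) + σ ^ 2) < ‖empCovOp (fun i => Ys i ω) - S‖}
  set B6 := {ω | ¬ (X ω ∈ (covOp X μ).range ∧ A (X ω) ∈ S.range)}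
  set B := B1 ∪ B2 ∪ B3 ∪ B4 ∪ B5 ∪ B6 with hB
  have hBle : μ.real B ≤ 5 * Real.exp (-τ ^ 2) := by
    have u1 := measureReal_union_le (μ := μ) (B1 ∪ B2 ∪ B3 ∪ B4 ∪ B5) B6
    have u2 := measureReal_union_le (μ := μ) (B1 ∪ B2 ∪ B3 ∪ B4) B5
    have u3 := measureReal_union_le (μ := μ) (B1 ∪ B2 ∪ B3) B4
    have u4 := measureReal_union_le (μ := μ) (B1 ∪ B2) B3
    have u5 := measureReal_union_le (μ := μ) B1 B2
    linarith
  -- The sample is only almost everywhere measurable, so the bad set is replaced by its measurable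
  -- hull. Its probability is at most `5e^(-τ²)`, strictly below the allowed `10e^(-τ²)`.
  refine ⟨(toMeasurable μ B)ᶜ, (measurableSet_toMeasurable μ B).compl, ?_, ?_⟩
  · rw [probReal_compl_eq_one_sub (measurableSet_toMeasurable μ B), measureReal_def,
      measure_toMeasurable, ← measureReal_def]
    have := Real.exp_pos (-τ ^ 2)
    linarith
  intro ω hω P hP t ht
  have hωB : ω ∉ B := fun h1 => hω (subset_toMeasurable μ B h1)
  simp only [hB, mem_union, not_or] at hωB
  obtain ⟨⟨⟨⟨⟨g1, g2⟩, g3⟩, g4⟩, g5⟩, g6⟩ := hωB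
  replace g1 : ‖(covOp X μ).range.starProjection (X ω)‖ ≤ 12 * (√h + τ) := not_lt.1 g1
  replace g2 : ‖S.range.starProjection (W ω)‖ ≤ 12 * (√h + τ) := not_lt.1 g2
  replace g3 : ‖A.range.starProjection (W ω)‖ ≤ 12 * (√d + τ) := not_lt.1 g3
  replace g4 : ‖(⊤ : Submodule ℝ (Euc m)).starProjection (W ω)‖ ≤ 12 * (√m + τ) := not_lt.1 g4
  replace g5 : ‖empCovOp (fun i => Ys i ω) - S‖ ≤ 32 * (672 * ((√m + τ) / √n) + σ ^ 2) :=
    not_lt.1 g5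
  obtain ⟨gX, gAX⟩ := not_not.1 g6
  rw [Submodule.starProjection_eq_self_iff.2 gX] at g1
  rw [Submodule.starProjection_eq_self_iff.2 Submodule.mem_top] at g4
  -- For `i > p`, `Πuᵢ = 0` by maximality of `p`, and `⟨uᵢ,AX⟩ = ⟨Πuᵢ,AX⟩`.
  have hpzero : ∀ i, p < i → inner ℝ (u i) (A (X ω)) = (0 : ℝ) := by
    intro i hi
    have h0 : S.range.starProjection (u i) = 0 := by
      by_contra hne
      exact (hp.2 hne).not_gt hi
    rw [← Submodule.starProjection_eq_self_iff.2 gAX,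
      ← Submodule.inner_starProjection_left_eq_right, h0, inner_zero_left]
  have hdk : ‖S.range.starProjection - P‖ ≤
      4 / lam * ‖empCovOp (fun i => Ys i ω) - S‖ :=
    norm_ranProj_sub_topEigenProj_le hSsym (empCovOp_isSymmetric _)
      (fun x => by rw [inner_empCovOp_self]; positivity) hlampos hSmin hSrank hP
  have hdet := hs.abs_empDerivFun_sub_derivFun_le hA hA1.le p (X ω) (W ω) hσ.le hpzero P ht
  rw [← hY ω] at hdet
  have hsig := norm_map_sub_topProj_le hA1.le (P := P) (w := W ω) hσ.le gAX
  rw [← hY ω] at hsig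
  have hsp := hs.pos hA p
  have hst := hs.pos hA ⊤
  have hτ0 := hτ.le
  have hproj : ‖S.range.starProjection - P‖ ≤
      86016 * (1 / lam * ((√m + τ) / √n + σ ^ 2)) := by
    refine hdk.trans ?_
    calc 4 / lam * ‖empCovOp (fun i => Ys i ω) - S‖
        ≤ 4 / lam * (32 * (672 * ((√m + τ) / √n) + σ ^ 2)) := by gcongr
      _ ≤ 4 / lam * (32 * (672 * ((√m + τ) / √n) + 672 * σ ^ 2)) := by
          gcongr; nlinarith [sq_nonneg σ]
      _ = _ := by ring
  have hterms := perturbation_terms_le_boundB (n := n) hhm hlampos hτ hσ hσ2.le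
  have herr : ‖A (X ω) - P (Y ω)‖ ≤ 12 * 86016 * (3 * boundB m h n lam τ σ) := by
    calc ‖A (X ω) - P (Y ω)‖ ≤ _ := hsig
      _ ≤ 86016 * (1 / lam * ((√m + τ) / √n + σ ^ 2)) *
            (12 * (√h + τ) + σ * (12 * (√m + τ))) + σ * (12 * (√h + τ)) := by gcongr
      _ ≤ 86016 * (1 / lam * ((√m + τ) / √n + σ ^ 2)) *
            (12 * (√h + τ) + σ * (12 * (√m + τ))) + 86016 * (σ * (12 * (√h + τ))) := by
          have : 0 ≤ σ * (12 * (√h + τ)) := by positivity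
          linarith
      _ = 12 * 86016 * (1 / lam * ((√m + τ) / √n + σ ^ 2) * ((√h + τ) + σ * (√m + τ)) +
            σ * (√h + τ)) := by ring
      _ ≤ _ := by gcongr
  have hB0 : 0 ≤ boundB m h n lam τ σ := by unfold boundB; positivity
  refine hdet.trans ?_
  calc ‖A (X ω) - P (Y ω)‖ *
        (1 / s p ^ 3 * ‖X ω‖ + σ / s ⊤ ^ 4 * ‖A.range.starProjection (W ω)‖)
      ≤ 12 * 86016 * (3 * boundB m h n lam τ σ) *
        (1 / s p ^ 3 * (12 * (√h + τ)) + σ / s ⊤ ^ 4 * (12 * (√d + τ))) := by gcongr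
    _ = 37158912 * (boundB m h n lam τ σ *
          (1 / s p ^ 3 * (√h + τ) + σ / s ⊤ ^ 4 * (√d + τ))) := by ring
    _ ≤ _ := by gcongr; norm_num
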